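/- A \emph{dotted composition} is a finite sequence $\alpha=(\alpha_1,\dots,\alpha_l)$ with entries in $\{1,2,3,\dots\}\cup\{\dot 0,\dot 1,\dot 2,\dots\}$; put $\eta_j=1$ if $\alpha_j$ is dotted and $\eta_j=0$ otherwise. Its total degree is $\sum_j\alpha_j$ (dots forgotten), and its fermionic degree $m_\alpha$ is the number of dotted entries. Let ${\rm sQSym}$ be the $\mathbb Q$-algebra of formal power series of bounded degree in commuting variables $x_1,x_2,\dots$ and anticommuting variables $\theta_1,\theta_2,\dots$ (the $x_i$ commute with the $\theta_j$) in which, for each $\alpha$, all monomials $\theta_{i_1}^{\eta_1}\cdots\theta_{i_l}^{\eta_l}x_{i_1}^{\alpha_1}\cdots x_{i_l}^{\alpha_l}$ with $i_1<\dots<i_l$ have the same coefficient. It has the basis of monomial functions $M_\alpha=\sum_{i_1<\dots<i_l}\theta_{i_1}^{\eta_1}\cdots\theta_{i_l}^{\eta_l}x_{i_1}^{\alpha_1}\cdots x_{i_l}^{\alpha_l}$, and the coproduct $\Delta f=f(x,y;\theta,\phi)$, where the variables are ordered by $x_1<x_2<\dots<y_1<y_2<\dots$ and $\theta_1<\theta_2<\dots<\phi_1<\phi_2<\dots$,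 the $\theta$'s and $\phi$'s anticommute, and $f\otimes g$ is identified with $f(x;\theta)\,g(y;\phi)$. Fix a sign $\varepsilon\in\{1,-1\}$. Let ${\rm sNSym}$ be the graded dual of ${\rm sQSym}$ (for the sum of the total and the fermionic degree), with the product, unit and coproduct determined by $$\langle FG,a\rangle=\langle F\otimes G,\Delta a\rangle,\qquad \langle 1,a\rangle=\text{constant term of }a,\qquad \langle\Delta F,a\otimes b\rangle=\langle F,ab\rangle,$$ where $\langle F\otimes G,a\otimes b\rangle=\varepsilon^{\deg(G)\deg(a)}\langle F,a\rangle\langle G,b\rangle$ for homogeneous elements and $\deg$ is the fermionic degree. ($\varepsilon=1$ is the pairing without signs; $\varepsilon=-1$ is the pairing formed with the twist $G\otimes a\mapsto(-1)^{\deg(G)\deg(a)}a\otimes G$.) Let $\{H_\alpha\}$ be the elements of ${\rm sNSym}$ with $\langle H_\alpha,M_\beta\rangle=\delta_{\alpha\beta}$, and put $H_m=H_{(m)}$ for $m\ge1$, $H_0=1$, and $\tilde H_n=H_{(\dot n)}$ for $n\ge0$. \textbf{Proposition.} For each $\varepsilon\in\{1,-1\}$: \begin{enumerate} \item The $M_\alpha$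 form a basis of ${\rm sQSym}$ and the $H_\alpha$ form the dual basis of ${\rm sNSym}$. For every dotted composition $\alpha=(\alpha_1,\dots,\alpha_l)$, $$H_\alpha=\varepsilon^{\binom{m_\alpha}{2}}\,H_{(\alpha_1)}H_{(\alpha_2)}\cdots H_{(\alpha_l)};$$ in particular $H_\alpha=H_{(\alpha_1)}\cdots H_{(\alpha_l)}$ for the pairing without signs. \item ${\rm sNSym}\cong\mathbb Q\langle H_1,H_2,\dots;\tilde H_0,\tilde H_1,\dots\rangle$: as an associative $\mathbb Q$-algebra, ${\rm sNSym}$ is free on the noncommuting generators $H_m$ ($m\ge1$) and $\tilde H_n$ ($n\ge0$). \item The coproduct is given on the generators by $$\Delta H_n=\sum_{i+j=n}H_i\otimes H_j\quad(n\ge1),\qquad \Delta\tilde H_i=\sum_{k+\ell=i}\bigl(\tilde H_k\otimes H_\ell+H_\ell\otimes\tilde H_k\bigr)\quad(i\ge0),$$ and it is determined by these values, since $\Delta(1)=1\otimes1$ and $\Delta(FG)=\Delta(F)\cdot\Delta(G)$, where $(F_1\otimes G_1)\cdot(F_2\otimes G_2)=(-1)^{\deg(G_1)\deg(F_2)}F_1F_2\otimes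 G_1G_2$ for homogeneous elements. \end{enumerate} -/

import Mathlib

open scoped TensorProduct

/-- A part of a dotted composition: an ordinary part `m ≥ 1`, or a dotted part `n ≥ 0`. -/
inductive DottedPart : Type
  | plain (m : ℕ+) : DottedPart
  | dotted (n : ℕ) : DottedPart
  deriving DecidableEq

namespace DottedPart

/-- The part with its dot forgotten. -/
def val : DottedPart → ℕ
  | plain m => (m : ℕ)
  | dotted n => n

/-- The exponent `η` of the anticommuting variable: `1` for a dotted part, `0` otherwise. -/
def eta : DottedPart → ℕ
  | plain _ => 0
  | dotted _ => 1

end DottedPart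

/-- Dotted compositions are finite sequences of parts; concatenation is `++`. -/
abbrev DottedComp : Type := List DottedPart

namespace DottedComp

/-- The total degree. -/
def totalDegree (α : DottedComp) : ℕ := (α.map DottedPart.val).sum

/-- The fermionic degree: the number of dotted parts. -/
def fermionicDegree (α : DottedComp) : ℕ := (α.map DottedPart.eta).sum

/-- The exponent vector of `x_{i_1}^{α_1} ⋯ x_{i_l}^{α_l}`. -/
noncomputable def xExp (α : DottedComp) (i : Fin α.length → ℕ) : ℕ →₀ ℕ :=
  ∑ j, Finsupp.single (i j) (α.get j).val

/-- The indices of the variables `θ` that occur in `θ_{i_1}^{η_1} ⋯ θ_{i_l}^{η_l}`. -/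
def thetaSet (α : DottedComp) (i : Fin α.length → ℕ) : Finset ℕ :=
  (Finset.univ.filter fun j => (α.get j).eta = 1).image i

end DottedComp

/-- Formal power series over `ℚ` in commuting variables `x_0, x_1, …` and anticommuting variables
`θ_0, θ_1, …` (the two families commute with each other). `f n S` is the coefficient of
`θ_{s_1} ⋯ θ_{s_k} x^n`, where `s_1 < ⋯ < s_k` are the elements of `S`. -/
abbrev SuperSeries : Type := (ℕ →₀ ℕ) → Finset ℕ → ℚ

namespace SuperSeries

/-- The sign with `θ_A θ_B = sign A B • θ_{A ∪ B}` for disjoint `A` and `B`, products of variables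
being written in increasing order. -/
def sign (A B : Finset ℕ) : ℚ := (-1) ^ ((A ×ˢ B).filter fun p => p.2 < p.1).card

/-- The product of two series. -/
noncomputable def mul (f g : SuperSeries) : SuperSeries := fun n S =>
  ∑ p ∈ Finset.HasAntidiagonal.antidiagonal n, ∑ A ∈ S.powerset,
    sign A (S \ A) * (f p.1 A * g p.2 (S \ A))

/-- Every monomial of `f` has degree (total plus fermionic) at most `N`. -/
def DegreeLE (f : SuperSeries) (N : ℕ) : Prop :=
  ∀ n S, N < n.degree + S.card → f n S = 0

/-- Every monomial of `f` has degree (total plus fermionic) larger than `N`. -/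
def DegreeGT (f : SuperSeries) (N : ℕ) : Prop :=
  ∀ n S, n.degree + S.card ≤ N → f n S = 0

/-- Quasisymmetry: for each dotted composition `α`, all monomials
`θ_{i_1}^{η_1} ⋯ θ_{i_l}^{η_l} x_{i_1}^{α_1} ⋯ x_{i_l}^{α_l}` with `i_1 < ⋯ < i_l` have the same
coefficient. -/
def IsQuasisymmetric (f : SuperSeries) : Prop :=
  ∀ (α : DottedComp) (i i' : Fin α.length → ℕ), StrictMono i → StrictMono i' →
    f (α.xExp i) (α.thetaSet i) = f (α.xExp i') (α.thetaSet i')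

end SuperSeries

/-- Quasisymmetric functions in superspace: the quasisymmetric series of bounded degree. -/
def SQSym : Submodule ℚ SuperSeries where
  carrier := {f | (∃ N, f.DegreeLE N) ∧ f.IsQuasisymmetric}
  zero_mem' := ⟨⟨0, fun _ _ _ => rfl⟩, fun _ _ _ _ _ => rfl⟩
  add_mem' := by
    rintro f g ⟨⟨N, hN⟩, hf⟩ ⟨⟨K, hK⟩, hg⟩
    refine ⟨⟨max N K, fun n S h => ?_⟩, fun α i i' hi hi' => ?_⟩
    · have h1 := hN n S (lt_of_le_of_lt (le_max_left _ _) h)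
      have h2 := hK n S (lt_of_le_of_lt (le_max_right _ _) h)
      simp [h1, h2]
    · simp only [Pi.add_apply]
      rw [hf α i i' hi hi', hg α i i' hi hi']
  smul_mem' := by
    rintro c f ⟨⟨N, hN⟩, hf⟩
    refine ⟨⟨N, fun n S h => ?_⟩, fun α i i' hi hi' => ?_⟩
    · simp [hN n S h]
    · simp only [Pi.smul_apply]
      rw [hf α i i' hi hi']

namespace SuperSeries

open DottedComp

/-! ### Monomials and the dotted compositions they carry -/

/-- The part carried by the index `j` in the monomial `θ_S x^n` (junk if `j` does not occur). -/
def partAt (n : ℕ →₀ ℕ) (S : Finset ℕ) (j : ℕ) : DottedPart :=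
  if j ∈ S then .dotted (n j) else if h : 0 < n j then .plain ⟨n j, h⟩ else .dotted 0

/-- The dotted composition carried by the monomial `θ_S x^n`. -/
def comp (n : ℕ →₀ ℕ) (S : Finset ℕ) : DottedComp :=
  ((n.support ∪ S).sort (· ≤ ·)).map (partAt n S)

theorem xExp_apply (α : DottedComp) {i : Fin α.length → ℕ} (hi : StrictMono i)
    (j : Fin α.length) : α.xExp i (i j) = (α.get j).val := by
  classical
  rw [xExp, Finsupp.finsetSum_apply, Finset.sum_eq_single j]
  · simp
  · intro k _ hk
    exact Finsupp.single_eq_of_ne (fun h => hk (hi.injective h.symm))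
  · simp

theorem mem_thetaSet (α : DottedComp) {i : Fin α.length → ℕ} (hi : StrictMono i)
    (j : Fin α.length) : i j ∈ α.thetaSet i ↔ (α.get j).eta = 1 := by
  simp [thetaSet, hi.injective.eq_iff]

theorem support_union_thetaSet (α : DottedComp) {i : Fin α.length → ℕ} (hi : StrictMono i) :
    (α.xExp i).support ∪ α.thetaSet i = Finset.univ.image i := by
  classical
  ext k
  simp only [Finset.mem_union, Finset.mem_image, Finset.mem_univ, true_and]
  constructor
  · rintro (h | h)
    · by_contra hk
      push Not at hk
      apply Finsupp.mem_support_iff.1 h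
      rw [xExp, Finsupp.finsetSum_apply]
      exact Finset.sum_eq_zero fun j _ => Finsupp.single_eq_of_ne (hk j).symm
    · simp only [thetaSet, Finset.mem_image] at h
      obtain ⟨j, _, hj⟩ := h
      exact ⟨j, hj⟩
  · rintro ⟨j, rfl⟩
    rw [Finsupp.mem_support_iff, xExp_apply α hi, mem_thetaSet α hi]
    rcases α.get j with m | n
    · left; exact m.pos.ne'
    · right; rfl

theorem sort_image_univ {l : ℕ} {i : Fin l → ℕ} (hi : StrictMono i) :
    (Finset.univ.image i).sort (· ≤ ·) = List.ofFn i := by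
  have h : (List.ofFn i).SortedLT := hi.sortedLT_ofFn
  have : Finset.univ.image i = (List.ofFn i).toFinset := by
    ext k; simp [List.mem_ofFn]
  rw [this]
  exact (List.toFinset_sort (· ≤ ·) h.nodup).2 h.sortedLE.pairwise

theorem comp_monomial (α : DottedComp) {i : Fin α.length → ℕ} (hi : StrictMono i) :
    comp (α.xExp i) (α.thetaSet i) = α := by
  rw [comp, support_union_thetaSet α hi, sort_image_univ hi, List.map_ofFn]
  conv_rhs => rw [← List.ofFn_get α]
  congr 1
  funext j
  simp only [Function.comp]
  have h1 := mem_thetaSet α hi j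
  have h2 := xExp_apply α hi j
  rcases hp : α.get j with m | m
  · have h3 : ¬ i j ∈ α.thetaSet i := by rw [h1, hp]; simp [DottedPart.eta]
    have h4 : α.xExp i (i j) = m := by rw [h2, hp]; rfl
    rw [partAt, if_neg h3, dif_pos (by rw [h4]; exact m.pos)]
    congr 1
    exact PNat.eq h4
  · have h3 : i j ∈ α.thetaSet i := by rw [h1, hp]; rfl
    rw [partAt, if_pos h3, h2, hp]
    rfl

theorem partAt_val (n : ℕ →₀ ℕ) (S : Finset ℕ) (j : ℕ) : (partAt n S j).val = n j := by
  unfold partAt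
  split_ifs with h1 h2
  · rfl
  · rfl
  · simp [DottedPart.val]; omega

theorem partAt_eta (n : ℕ →₀ ℕ) (S : Finset ℕ) {j : ℕ} (hj : j ∈ n.support ∪ S) :
    (partAt n S j).eta = 1 ↔ j ∈ S := by
  unfold partAt
  split_ifs with h1 h2
  · simp [DottedPart.eta, h1]
  · simp [DottedPart.eta, h1]
  · simp [h1] at hj; omega

theorem exists_monomial (n : ℕ →₀ ℕ) (S : Finset ℕ) :
    ∃ i : Fin (comp n S).length → ℕ, StrictMono i ∧
      (comp n S).xExp i = n ∧ (comp n S).thetaSet i = S := by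
  classical
  set T := n.support ∪ S with hT
  have hlen : (comp n S).length = (T.sort (· ≤ ·)).length := by simp [comp, hT]
  have hmono : StrictMono (T.sort (· ≤ ·)).get := (Finset.sortedLT_sort T).strictMono_get
  have hmem : ∀ k, k ∈ T ↔ ∃ j, (T.sort (· ≤ ·)).get j = k := by
    intro k
    rw [← List.mem_iff_get, Finset.mem_sort]
  have hget : ∀ j, (comp n S).get j = partAt n S ((T.sort (· ≤ ·)).get (Fin.cast hlen j)) := by
    intro j; exact List.getElem_map (partAt n S)
  have hi : StrictMono fun j => (T.sort (· ≤ ·)).get (Fin.cast hlen j) :=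
    fun a b h => hmono h
  refine ⟨_, hi, ?_, ?_⟩
  · ext k
    by_cases hk : k ∈ T
    · obtain ⟨j, rfl⟩ := (hmem k).1 hk
      have := xExp_apply (comp n S) hi (Fin.cast hlen.symm j)
      rw [hget, partAt_val] at this
      exact this
    · have h1 : n k = 0 := by
        by_contra h; exact hk (Finset.mem_union_left _ (Finsupp.mem_support_iff.2 h))
      rw [h1]
      by_contra h
      have := Finset.mem_union_left
        ((comp n S).thetaSet fun j => (T.sort (· ≤ ·)).get (Fin.cast hlen j))
        (Finsupp.mem_support_iff.2 h)
      rw [support_union_thetaSet _ hi] at this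
      simp only [Finset.mem_image, Finset.mem_univ, true_and] at this
      obtain ⟨j, hj⟩ := this
      exact hk ((hmem k).2 ⟨_, hj⟩)
  · ext k
    by_cases hk : k ∈ T
    · obtain ⟨j, rfl⟩ := (hmem k).1 hk
      have := mem_thetaSet (comp n S) hi (Fin.cast hlen.symm j)
      rw [hget, partAt_eta n S ((hmem _).2 ⟨_, rfl⟩)] at this
      exact this
    · constructor
      · intro h
        have := Finset.mem_union_right
          ((comp n S).xExp fun j => (T.sort (· ≤ ·)).get (Fin.cast hlen j)).support h
        rw [support_union_thetaSet _ hi] at this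
        simp only [Finset.mem_image, Finset.mem_univ, true_and] at this
        obtain ⟨j, hj⟩ := this
        exact absurd ((hmem k).2 ⟨_, hj⟩) hk
      · intro h
        exact absurd (Finset.mem_union_right _ h) hk

/-- The coefficient in `f` of the leading term `θ_0^{η_1} θ_1^{η_2} ⋯ x_0^{α_1} x_1^{α_2} ⋯`. -/
noncomputable def leadingCoeff (f : SuperSeries) (α : DottedComp) : ℚ :=
  f (α.xExp Fin.val) (α.thetaSet Fin.val)

theorem IsQuasisymmetric.coeff_eq {f : SuperSeries} (hf : f.IsQuasisymmetric)
    (n : ℕ →₀ ℕ) (S : Finset ℕ) : f n S = leadingCoeff f (comp n S) := by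
  obtain ⟨i, hi, h1, h2⟩ := exists_monomial n S
  have h := hf _ _ _ hi Fin.val_strictMono
  rw [h1, h2] at h
  exact h

theorem isQuasisymmetric_of_comp {f : SuperSeries} (c : DottedComp → ℚ)
    (h : ∀ n S, f n S = c (comp n S)) : f.IsQuasisymmetric := by
  intro α i i' hi hi'
  rw [h, h, comp_monomial α hi, comp_monomial α hi']

/-- The degree (total plus fermionic) of a dotted composition. -/
def weight (α : DottedComp) : ℕ := totalDegree α + fermionicDegree α

theorem degree_comp (n : ℕ →₀ ℕ) (S : Finset ℕ) : totalDegree (comp n S) = n.degree := by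
  rw [totalDegree, comp, List.map_map]
  have : DottedPart.val ∘ partAt n S = n := funext (partAt_val n S)
  rw [this, Finsupp.degree_apply]
  rw [← List.sum_toFinset _ (Finset.sort_nodup _ _), Finset.sort_toFinset]
  exact (Finset.sum_subset Finset.subset_union_left (by simp)).symm

theorem card_comp (n : ℕ →₀ ℕ) (S : Finset ℕ) : fermionicDegree (comp n S) = S.card := by
  rw [fermionicDegree, comp, List.map_map]
  rw [← List.sum_toFinset _ (Finset.sort_nodup _ _), Finset.sort_toFinset]
  have : ∀ j ∈ n.support ∪ S, (DottedPart.eta ∘ partAt n S) j = if j ∈ S then 1 else 0 := by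
    intro j hj
    have h := partAt_eta n S hj
    simp only [Function.comp]
    split_ifs with hS
    · exact h.2 hS
    · rcases hp : partAt n S j with m | m
      · rfl
      · rw [hp] at h; exact absurd (h.1 rfl) hS
  rw [Finset.sum_congr rfl this]
  simp

theorem weight_comp (n : ℕ →₀ ℕ) (S : Finset ℕ) : weight (comp n S) = n.degree + S.card := by
  rw [weight, degree_comp, card_comp]

theorem finite_weight_le (N : ℕ) : {α : DottedComp | weight α ≤ N}.Finite := by
  induction N with
  | zero =>
    refine (Set.finite_singleton ([] : DottedComp)).subset ?_
    rintro (_ | ⟨p, α⟩) h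
    · rfl
    · exfalso
      rcases p with m | m
      · have := m.pos
        simp [weight, totalDegree, fermionicDegree, DottedPart.val, DottedPart.eta] at h
      · simp [weight, totalDegree, fermionicDegree, DottedPart.val, DottedPart.eta] at h
  | succ N ih =>
    have hP : {p : DottedPart | p.val + p.eta ≤ N + 1}.Finite := by
      refine (((Set.finite_Iic (N + 1)).image fun k => DottedPart.dotted k).union
        ((Set.finite_Iic (N + 1)).image fun k => DottedPart.plain (Nat.toPNat' k))).subset ?_
      rintro (m | m) h
      · right
        refine ⟨m, ?_, by simp⟩
        simpa [DottedPart.val, DottedPart.eta] using h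
      · left
        refine ⟨m, ?_, rfl⟩
        simp [DottedPart.val, DottedPart.eta] at h ⊢
        omega
    refine ((Set.finite_singleton ([] : DottedComp)).union
      (Set.Finite.image2 List.cons hP ih)).subset ?_
    rintro (_ | ⟨p, α⟩) h
    · left; rfl
    · right
      have hp : 1 ≤ p.val + p.eta := by
        rcases p with m | m
        · exact m.pos
        · simp [DottedPart.eta]
      simp only [Set.mem_ofPred_eq, weight, totalDegree, fermionicDegree, List.map_cons,
        List.sum_cons] at h
      refine ⟨p, ?_, α, ?_, rfl⟩ <;>
        simp only [Set.mem_ofPred_eq, weight, totalDegree, fermionicDegree] <;> omega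

end SuperSeries

namespace SuperSeries

open DottedComp Finset

/-! ### The product of quasisymmetric series is quasisymmetric -/

theorem support_mapDomain {e : ℕ → ℕ} (he : StrictMono e) (n : ℕ →₀ ℕ) :
    (n.mapDomain e).support = n.support.image e :=
  Finsupp.mapDomain_support_of_injective he.injective n

theorem sort_image {e : ℕ → ℕ} (he : StrictMono e) (T : Finset ℕ) :
    (T.image e).sort (· ≤ ·) = (T.sort (· ≤ ·)).map e := by
  have h1 : ((T.sort (· ≤ ·)).map e).SortedLT :=
    ((Finset.sortedLT_sort T).pairwise.map e fun _ _ h => he h).sortedLT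
  have : T.image e = ((T.sort (· ≤ ·)).map e).toFinset := by
    ext k; simp
  rw [this]
  exact (List.toFinset_sort (· ≤ ·) h1.nodup).2 h1.sortedLE.pairwise

theorem comp_map {e : ℕ → ℕ} (he : StrictMono e) (n : ℕ →₀ ℕ) (S : Finset ℕ) :
    comp (n.mapDomain e) (S.image e) = comp n S := by
  rw [comp, comp, support_mapDomain he, ← Finset.image_union, sort_image he, List.map_map]
  congr 1
  funext j
  simp only [Function.comp, partAt, Finsupp.mapDomain_apply he.injective,
    he.injective.mem_finset_image]

theorem IsQuasisymmetric.map_eq {f : SuperSeries} (hf : f.IsQuasisymmetric) {e : ℕ → ℕ}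
    (he : StrictMono e) (n : ℕ →₀ ℕ) (S : Finset ℕ) :
    f (n.mapDomain e) (S.image e) = f n S := by
  rw [hf.coeff_eq, comp_map he, ← hf.coeff_eq]

theorem exists_strictMono_extend {l : ℕ} {i : Fin l → ℕ} (hi : StrictMono i) :
    ∃ e : ℕ → ℕ, StrictMono e ∧ ∀ j, e (j : Fin l) = i j := by
  refine ⟨fun k => if h : k < l then i ⟨k, h⟩ else (∑ j, i j) + 1 + k, ?_, fun j => by simp⟩
  intro a b hab
  simp only
  split_ifs with h1 h2 h2
  · exact hi hab
  · have : i ⟨a, h1⟩ ≤ ∑ j, i j := single_le_sum (fun _ _ => Nat.zero_le _) (mem_univ _)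
    omega
  · omega
  · omega

theorem isQuasisymmetric_of_map {f : SuperSeries}
    (h : ∀ e : ℕ → ℕ, StrictMono e → ∀ n S, f (n.mapDomain e) (S.image e) = f n S) :
    f.IsQuasisymmetric := by
  have key : ∀ (α : DottedComp) (i : Fin α.length → ℕ), StrictMono i →
      f (α.xExp i) (α.thetaSet i) = leadingCoeff f α := by
    intro α i hi
    obtain ⟨e, he, hei⟩ := exists_strictMono_extend hi
    have h1 : α.xExp i = (α.xExp Fin.val).mapDomain e := by
      simp only [xExp, Finsupp.mapDomain_finsetSum, Finsupp.mapDomain_single, hei]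
    have h2 : α.thetaSet i = (α.thetaSet Fin.val).image e := by
      simp only [thetaSet, Finset.image_image, Function.comp_def, hei]
    rw [h1, h2, h e he, leadingCoeff]
  intro α i i' hi hi'
  rw [key α i hi, key α i' hi']

theorem sign_image {e : ℕ → ℕ} (he : StrictMono e) (A B : Finset ℕ) :
    sign (A.image e) (B.image e) = sign A B := by
  unfold sign
  congr 1
  symm
  refine Finset.card_bij (fun p _ => (e p.1, e p.2)) ?_ ?_ ?_
  · rintro ⟨a, b⟩ h
    simp only [mem_filter, mem_product] at h ⊢
    exact ⟨⟨mem_image_of_mem _ h.1.1, mem_image_of_mem _ h.1.2⟩, he h.2⟩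
  · rintro ⟨a, b⟩ _ ⟨a', b'⟩ _ h
    simp only [Prod.mk.injEq] at h
    exact Prod.ext (he.injective h.1) (he.injective h.2)
  · rintro ⟨a, b⟩ h
    simp only [mem_filter, mem_product, mem_image] at h
    obtain ⟨⟨⟨a', ha', rfl⟩, b', hb', rfl⟩, h⟩ := h
    exact ⟨(a', b'), by simpa [ha', hb'] using he.lt_iff_lt.1 h, rfl⟩

theorem sum_antidiagonal_mapDomain {e : ℕ → ℕ} (he : StrictMono e) (n : ℕ →₀ ℕ)
    (c : (ℕ →₀ ℕ) → (ℕ →₀ ℕ) → ℚ) :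
    ∑ p ∈ HasAntidiagonal.antidiagonal (n.mapDomain e), c p.1 p.2 =
      ∑ p ∈ HasAntidiagonal.antidiagonal n, c (p.1.mapDomain e) (p.2.mapDomain e) := by
  symm
  refine Finset.sum_bij (fun p _ => (p.1.mapDomain e, p.2.mapDomain e)) ?_ ?_ ?_ ?_
  · rintro ⟨p, q⟩ h
    rw [HasAntidiagonal.mem_antidiagonal] at h ⊢
    simp only at h ⊢
    rw [← Finsupp.mapDomain_add, h]
  · rintro ⟨p, q⟩ _ ⟨p', q'⟩ _ h
    simp only [Prod.mk.injEq] at h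
    exact Prod.ext (Finsupp.mapDomain_injective he.injective h.1)
      (Finsupp.mapDomain_injective he.injective h.2)
  · rintro ⟨p, q⟩ h
    rw [HasAntidiagonal.mem_antidiagonal] at h
    simp only at h
    have hzero : ∀ k, k ∉ Set.range e → p k = 0 ∧ q k = 0 := by
      intro k hk
      have := DFunLike.congr_fun h k
      rw [Finsupp.mapDomain_of_notMem_range _ _ hk, Finsupp.add_apply] at this
      omega
    have hp : (p.comapDomain e he.injective.injOn).mapDomain e = p :=
      Finsupp.mapDomain_comapDomain e he.injective p fun k hk => by
        by_contra hk'
        exact Finsupp.mem_support_iff.1 hk (hzero k hk').1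
    have hq : (q.comapDomain e he.injective.injOn).mapDomain e = q :=
      Finsupp.mapDomain_comapDomain e he.injective q fun k hk => by
        by_contra hk'
        exact Finsupp.mem_support_iff.1 hk (hzero k hk').2
    refine ⟨(p.comapDomain e he.injective.injOn, q.comapDomain e he.injective.injOn), ?_, ?_⟩
    · rw [HasAntidiagonal.mem_antidiagonal]
      apply Finsupp.mapDomain_injective he.injective
      simp only
      rw [Finsupp.mapDomain_add, hp, hq, h]
    · simp only [hp, hq]
  · intro _ _
    rfl

theorem IsQuasisymmetric.mul {f g : SuperSeries} (hf : f.IsQuasisymmetric)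
    (hg : g.IsQuasisymmetric) : (SuperSeries.mul f g).IsQuasisymmetric := by
  apply isQuasisymmetric_of_map
  intro e he n S
  unfold SuperSeries.mul
  rw [sum_antidiagonal_mapDomain he n fun p q => ∑ A ∈ (S.image e).powerset,
    sign A (S.image e \ A) * (f p A * g q (S.image e \ A))]
  refine Finset.sum_congr rfl fun p _ => ?_
  symm
  refine Finset.sum_bij (fun A _ => A.image e) ?_ ?_ ?_ ?_
  · intro A hA
    rw [mem_powerset] at hA ⊢
    exact image_subset_image hA
  · intro A _ B _ h
    exact Finset.image_injective he.injective h
  · intro B hB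
    rw [mem_powerset, subset_image_iff] at hB
    obtain ⟨A, hA, rfl⟩ := hB
    exact ⟨A, by simpa using hA, rfl⟩
  · intro A _
    rw [← Finset.image_sdiff _ _ he.injective, sign_image he, hf.map_eq he, hg.map_eq he]

theorem card_add_card_sdiff {A S : Finset ℕ} (h : A ∈ S.powerset) :
    A.card + (S \ A).card = S.card := by
  rw [mem_powerset] at h
  have := Finset.card_sdiff_add_card_eq_card h
  omega

theorem degree_of_mem_antidiagonal {n : ℕ →₀ ℕ} {p : (ℕ →₀ ℕ) × (ℕ →₀ ℕ)}
    (h : p ∈ HasAntidiagonal.antidiagonal n) : p.1.degree + p.2.degree = n.degree := by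
  rw [HasAntidiagonal.mem_antidiagonal] at h
  rw [← h, map_add]

theorem DegreeLE.mul {f g : SuperSeries} {N K : ℕ} (hf : f.DegreeLE N) (hg : g.DegreeLE K) :
    (SuperSeries.mul f g).DegreeLE (N + K) := by
  intro n S h
  refine Finset.sum_eq_zero fun p hp => Finset.sum_eq_zero fun A hA => ?_
  have h1 := card_add_card_sdiff hA
  have h2 := degree_of_mem_antidiagonal hp
  by_cases h3 : N < p.1.degree + A.card
  · rw [hf _ _ h3]; ring
  · rw [hg _ _ (by omega)]; ring

theorem mul_add_left (f f' g : SuperSeries) : mul (f + f') g = mul f g + mul f' g := by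
  funext n S
  simp only [mul, Pi.add_apply, ← Finset.sum_add_distrib]
  exact Finset.sum_congr rfl fun _ _ => Finset.sum_congr rfl fun _ _ => by ring

theorem mul_add_right (f g g' : SuperSeries) : mul f (g + g') = mul f g + mul f g' := by
  funext n S
  simp only [mul, Pi.add_apply, ← Finset.sum_add_distrib]
  exact Finset.sum_congr rfl fun _ _ => Finset.sum_congr rfl fun _ _ => by ring

theorem mul_smul_left (c : ℚ) (f g : SuperSeries) : mul (c • f) g = c • mul f g := by
  funext n S
  simp only [mul, Pi.smul_apply, smul_eq_mul, Finset.mul_sum]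
  exact Finset.sum_congr rfl fun _ _ => Finset.sum_congr rfl fun _ _ => by ring

theorem mul_smul_right (c : ℚ) (f g : SuperSeries) : mul f (c • g) = c • mul f g := by
  funext n S
  simp only [mul, Pi.smul_apply, smul_eq_mul, Finset.mul_sum]
  exact Finset.sum_congr rfl fun _ _ => Finset.sum_congr rfl fun _ _ => by ring

end SuperSeries

namespace SQSym

open SuperSeries DottedComp

/-- The product of quasisymmetric functions in superspace. -/
noncomputable def mulL : SQSym →ₗ[ℚ] SQSym →ₗ[ℚ] SQSym :=
  LinearMap.mk₂ ℚ
    (fun f g => ⟨SuperSeries.mul f g, by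
      obtain ⟨⟨N, hN⟩, hf⟩ := f.2
      obtain ⟨⟨K, hK⟩, hg⟩ := g.2
      exact ⟨⟨N + K, hN.mul hK⟩, hf.mul hg⟩⟩)
    (fun f f' g => Subtype.ext (mul_add_left f.1 f'.1 g.1))
    (fun c f g => Subtype.ext (mul_smul_left c f.1 g.1))
    (fun f g g' => Subtype.ext (mul_add_right f.1 g.1 g'.1))
    (fun c f g => Subtype.ext (mul_smul_right c f.1 g.1))

open Classical in
/-- The monomial quasisymmetric function in superspace: the sum of all monomials
`θ_{i_1}^{η_1} ⋯ θ_{i_l}^{η_l} x_{i_1}^{α_1} ⋯ x_{i_l}^{α_l}` with `i_1 < ⋯ < i_l`. (Distinct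
sequences give distinct monomials, so each monomial that occurs has coefficient `1`.) -/
noncomputable def monomialSeries (α : DottedComp) : SuperSeries := fun n S =>
  if ∃ i : Fin α.length → ℕ, StrictMono i ∧ α.xExp i = n ∧ α.thetaSet i = S then 1 else 0

theorem monomialSeries_apply (α : DottedComp) (n : ℕ →₀ ℕ) (S : Finset ℕ) :
    monomialSeries α n S = if comp n S = α then 1 else 0 := by
  unfold monomialSeries
  congr 1
  apply propext
  constructor
  · rintro ⟨i, hi, rfl, rfl⟩
    exact comp_monomial α hi
  · rintro rfl
    exact exists_monomial n S

/-- `M_α` as an element of `SQSym`. -/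
noncomputable def M (α : DottedComp) : SQSym :=
  ⟨monomialSeries α, ⟨weight α, fun n S h => by
    rw [monomialSeries_apply, if_neg]
    rintro rfl
    rw [weight_comp] at h
    exact lt_irrefl _ h⟩,
    isQuasisymmetric_of_comp (fun β => if β = α then 1 else 0) (monomialSeries_apply α)⟩

theorem M_apply (α : DottedComp) (n : ℕ →₀ ℕ) (S : Finset ℕ) :
    (M α).1 n S = if comp n S = α then 1 else 0 := monomialSeries_apply α n S

theorem ext_lead {f g : SQSym} (h : ∀ α, leadingCoeff f.1 α = leadingCoeff g.1 α) : f = g := by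
  apply Subtype.ext
  funext n S
  rw [f.2.2.coeff_eq, g.2.2.coeff_eq, h]

theorem lead_M (α β : DottedComp) :
    leadingCoeff (M α).1 β = if β = α then 1 else 0 := by
  rw [leadingCoeff, M_apply, comp_monomial β Fin.val_strictMono]

theorem weight_eq (α : DottedComp) :
    (α.xExp Fin.val).degree + (α.thetaSet Fin.val).card = weight α := by
  rw [← weight_comp, comp_monomial α Fin.val_strictMono]

/-- The expansion of a quasisymmetric function in the `M_α`. -/
noncomputable def coords (f : SQSym) : DottedComp →₀ ℚ :=
  Finsupp.ofSupportFinite (leadingCoeff f.1) (by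
    obtain ⟨N, hN⟩ := f.2.1
    refine (finite_weight_le N).subset fun α hα => ?_
    by_contra h
    rw [Set.mem_ofPred_eq, not_le] at h
    refine hα (hN _ _ ?_)
    rwa [weight_eq])

theorem coords_apply (f : SQSym) (α : DottedComp) : coords f α = leadingCoeff f.1 α := rfl

/-- The leading coefficient at `β` as a linear functional. -/
noncomputable def leadL (β : DottedComp) : SQSym →ₗ[ℚ] ℚ where
  toFun f := leadingCoeff f.1 β
  map_add' _ _ := rfl
  map_smul' _ _ := rfl

theorem lead_linearCombination (c : DottedComp →₀ ℚ) (β : DottedComp) :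
    leadingCoeff (Finsupp.linearCombination ℚ M c).1 β = c β := by
  have h : ∀ α, (leadL β ∘ M) α = if β = α then (1 : ℚ) else 0 := fun α => lead_M α β
  have h2 : leadL β (Finsupp.linearCombination ℚ M c) = c β := by
    rw [Finsupp.apply_linearCombination, Finsupp.linearCombination_apply, Finsupp.sum]
    simp only [h, smul_eq_mul, mul_ite, mul_one, mul_zero]
    rw [Finset.sum_ite_eq]
    simp [eq_comm]
  exact h2

/-- The monomial quasisymmetric functions in superspace form a basis. -/
noncomputable def basisM : Module.Basis DottedComp ℚ SQSym :=
  .ofRepr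
    { toFun := coords
      map_add' := fun _ _ => Finsupp.ext fun _ => rfl
      map_smul' := fun _ _ => Finsupp.ext fun _ => rfl
      invFun := fun c => Finsupp.linearCombination ℚ M c
      left_inv := fun f => ext_lead fun β => lead_linearCombination (coords f) β
      right_inv := fun c => Finsupp.ext fun β => lead_linearCombination c β }

theorem basisM_repr (f : SQSym) (α : DottedComp) :
    basisM.repr f α = leadingCoeff f.1 α := rfl

theorem basisM_apply (α : DottedComp) : basisM α = M α := by
  apply basisM.repr.injective
  ext β
  rw [basisM.repr_self, basisM_repr, lead_M, Finsupp.single_apply]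
  simp only [eq_comm]

end SQSym

namespace SuperSeries

open DottedComp Finset

/-- A number exceeding every index of a variable that occurs in `θ_A x^n`. -/
def indexBound (n : ℕ →₀ ℕ) (A : Finset ℕ) : ℕ := (n.support ∪ A).sup (· + 1)

/-- The series `f(x,y;θ,φ)`, the variables being ordered by
`x_0 < x_1 < ⋯ < y_0 < y_1 < ⋯` and `θ_0 < θ_1 < ⋯ < φ_0 < φ_1 < ⋯`.
The value at `n A m B` is the coefficient of `θ_A φ_B x^n y^m`; it is read off after
substituting `x_0, …, x_{K-1}, y_0, y_1, …` for the variables of `f`, with `K` so large that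
`θ_A x^n` involves indices less than `K` only. -/
noncomputable def twoAlphabets (f : SuperSeries) (n : ℕ →₀ ℕ) (A : Finset ℕ) (m : ℕ →₀ ℕ)
    (B : Finset ℕ) : ℚ :=
  f (n + m.mapDomain (indexBound n A + ·)) (A ∪ B.image (indexBound n A + ·))

theorem lt_indexBound {n : ℕ →₀ ℕ} {A : Finset ℕ} {j : ℕ} (hj : j ∈ n.support ∪ A) :
    j < indexBound n A :=
  Finset.le_sup (f := (· + 1)) hj

theorem comp_two (n : ℕ →₀ ℕ) (A : Finset ℕ) (m : ℕ →₀ ℕ) (B : Finset ℕ) :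
    comp (n + m.mapDomain (indexBound n A + ·)) (A ∪ B.image (indexBound n A + ·)) =
      comp n A ++ comp m B := by
  have hlt := fun j => lt_indexBound (n := n) (A := A) (j := j)
  generalize indexBound n A = K at *
  have he : StrictMono (K + ·) := fun a b h => Nat.add_lt_add_left h K
  have hzero : ∀ j, j < K → (m.mapDomain (K + ·)) j = 0 := by
    intro j hj
    apply Finsupp.mapDomain_of_notMem_range
    rintro ⟨k, hk⟩
    simp only at hk
    omega
  have hzero' : ∀ j, K ≤ j → n j = 0 ∧ j ∉ A := by
    intro j hj
    have : j ∉ n.support ∪ A := fun h => absurd (hlt j h) (by omega)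
    simpa using this
  have hsupp : (n + m.mapDomain (K + ·)).support ∪ (A ∪ B.image (K + ·)) =
      (n.support ∪ A) ∪ (m.support ∪ B).image (K + ·) := by
    have : (n + m.mapDomain (K + ·)).support = n.support ∪ m.support.image (K + ·) := by
      rw [← support_mapDomain he]
      ext j
      simp only [Finsupp.mem_support_iff, Finsupp.add_apply, mem_union]
      omega
    rw [this, image_union]
    ext j
    simp only [mem_union]
    tauto
  have hsort : ((n.support ∪ A) ∪ (m.support ∪ B).image (K + ·)).sort (· ≤ ·) =
      (n.support ∪ A).sort (· ≤ ·) ++ ((m.support ∪ B).sort (· ≤ ·)).map (K + ·) := by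
    rw [← sort_image he]
    generalize hT : (m.support ∪ B).image (K + ·) = T
    have hlist : ((n.support ∪ A).sort (· ≤ ·) ++ T.sort (· ≤ ·)).SortedLT := by
      refine (List.pairwise_append.2 ⟨(Finset.sortedLT_sort _).pairwise,
        (Finset.sortedLT_sort _).pairwise, ?_⟩).sortedLT
      intro a ha b hb
      rw [Finset.mem_sort] at ha hb
      have h1 := hlt a ha
      rw [← hT, mem_image] at hb
      obtain ⟨c, _, rfl⟩ := hb
      omega
    have : (n.support ∪ A) ∪ T =
        ((n.support ∪ A).sort (· ≤ ·) ++ T.sort (· ≤ ·)).toFinset := by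
      ext j; simp
    rw [this]
    exact (List.toFinset_sort (· ≤ ·) hlist.nodup).2 hlist.sortedLE.pairwise
  rw [comp, hsupp, hsort, List.map_append, List.map_map, comp, comp]
  congr 1
  · apply List.map_congr_left
    intro j hj
    rw [Finset.mem_sort] at hj
    have h1 := hlt j hj
    have h2 : j ∉ B.image (K + ·) := by
      rw [mem_image]; rintro ⟨k, _, hk⟩; omega
    simp only [partAt, mem_union, h2, or_false, Finsupp.add_apply, hzero j h1, add_zero]
  · apply List.map_congr_left
    intro j _
    have h1 := hzero' (K + j) (by omega)
    have h2 : K + j ∈ B.image (K + ·) ↔ j ∈ B := he.injective.mem_finset_image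
    have h3 : (m.mapDomain (K + ·)) (K + j) = m j :=
      Finsupp.mapDomain_apply he.injective m j
    simp only [Function.comp, partAt, mem_union, h1.2, false_or, h2, Finsupp.add_apply, h1.1,
      zero_add, h3]

theorem sum_take_drop (α β γ : DottedComp) (c : DottedComp → DottedComp → ℚ) :
    ∑ k ∈ range (α.length + 1),
      (if β = α.take k then (1 : ℚ) else 0) * (if γ = α.drop k then 1 else 0) *
        c (α.take k) (α.drop k) = if β ++ γ = α then c β γ else 0 := by
  split_ifs with h
  · subst h
    rw [Finset.sum_eq_single β.length]
    · simp
    · intro k _ hk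
      by_cases h1 : β = (β ++ γ).take k
      · by_cases h2 : γ = (β ++ γ).drop k
        · exfalso
          have h3 := congrArg List.length h1
          have h4 := congrArg List.length h2
          simp only [List.length_take, List.length_drop, List.length_append] at h3 h4
          rename_i hk'
          simp only [mem_range, List.length_append] at hk'
          omega
        · simp [h2]
      · simp [h1]
    · simp
  · refine Finset.sum_eq_zero fun k _ => ?_
    by_cases h1 : β = α.take k
    · by_cases h2 : γ = α.drop k
      · exact absurd (by rw [h1, h2, List.take_append_drop]) h
      · simp [h2]
    · simp [h1]

theorem DegreeGT.mul_left {f : SuperSeries} {N : ℕ} (hf : f.DegreeGT N) (g : SuperSeries) :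
    (mul f g).DegreeGT N := by
  intro n S h
  refine Finset.sum_eq_zero fun p hp => Finset.sum_eq_zero fun A hA => ?_
  have h1 := card_add_card_sdiff hA
  have h2 := degree_of_mem_antidiagonal hp
  rw [hf _ _ (by omega)]
  ring

theorem DegreeGT.mul_right {g : SuperSeries} {N : ℕ} (hg : g.DegreeGT N) (f : SuperSeries) :
    (mul f g).DegreeGT N := by
  intro n S h
  refine Finset.sum_eq_zero fun p hp => Finset.sum_eq_zero fun A hA => ?_
  have h1 := card_add_card_sdiff hA
  have h2 := degree_of_mem_antidiagonal hp
  rw [hg _ _ (by omega)]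
  ring

theorem weight_append (α β : DottedComp) : weight (α ++ β) = weight α + weight β := by
  simp [weight, totalDegree, fermionicDegree]; omega

end SuperSeries

namespace SQSym

open SuperSeries DottedComp

/-! ### The coproduct -/

/-- Series in two families of variables: the value at `n A m B` is the coefficient of
`θ_A φ_B x^n y^m`. -/
abbrev TwoSeries : Type :=
  (ℕ →₀ ℕ) → Finset ℕ → (ℕ →₀ ℕ) → Finset ℕ → ℚ

/-- The identification of `f ⊗ g` with `f(x;θ) g(y;φ)`. -/
noncomputable def tensorToTwo : SQSym ⊗[ℚ] SQSym →ₗ[ℚ] TwoSeries :=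
  TensorProduct.lift (LinearMap.mk₂ ℚ (fun f g n A m B => f.1 n A * g.1 m B)
    (fun f f' g => by funext n A m B; simp [add_mul])
    (fun c f g => by funext n A m B; simp [mul_assoc])
    (fun f g g' => by funext n A m B; simp [mul_add])
    (fun c f g => by funext n A m B; simp [mul_left_comm]))

theorem tensorToTwo_tmul (f g : SQSym) (n : ℕ →₀ ℕ) (A : Finset ℕ) (m : ℕ →₀ ℕ)
    (B : Finset ℕ) : tensorToTwo (f ⊗ₜ g) n A m B = f.1 n A * g.1 m B := rfl

/-- The map `f ↦ f(x,y;θ,φ)`. -/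
noncomputable def toTwo : SQSym →ₗ[ℚ] TwoSeries where
  toFun f := twoAlphabets f.1
  map_add' _ _ := rfl
  map_smul' _ _ := rfl

theorem tensorToTwo_injective : Function.Injective tensorToTwo := by
  have key : ∀ (t : SQSym ⊗[ℚ] SQSym) (α β : DottedComp),
      (basisM.tensorProduct basisM).repr t (α, β) =
      tensorToTwo t (α.xExp Fin.val) (α.thetaSet Fin.val)
        (β.xExp Fin.val) (β.thetaSet Fin.val) := by
    intro t α β
    induction t using TensorProduct.induction_on with
    | zero => simp
    | tmul f g => simp [basisM_repr, leadingCoeff, tensorToTwo_tmul, mul_comm]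
    | add s t hs ht => simp only [map_add, Finsupp.add_apply, Pi.add_apply, hs, ht]
  intro t t' h
  apply (basisM.tensorProduct basisM).repr.injective
  ext ⟨α, β⟩
  rw [key, key, h]

theorem toTwo_M (α : DottedComp) :
    toTwo (M α) = tensorToTwo (∑ k ∈ Finset.range (α.length + 1),
      M (α.take k) ⊗ₜ M (α.drop k)) := by
  funext n A m B
  have h := sum_take_drop α (comp n A) (comp m B) (fun _ _ => 1)
  simp only [mul_one] at h
  rw [map_sum]
  simp only [Finset.sum_apply, tensorToTwo_tmul, M_apply]
  rw [h]
  change (M α).1 _ _ = _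
  rw [M_apply, comp_two]

theorem toTwo_mem (f : SQSym) : toTwo f ∈ LinearMap.range tensorToTwo := by
  rw [← basisM.linearCombination_repr f, Finsupp.linearCombination_apply, Finsupp.sum, map_sum]
  refine Submodule.sum_mem _ fun α _ => ?_
  rw [map_smul, basisM_apply, toTwo_M]
  exact Submodule.smul_mem _ _ ⟨_, rfl⟩

/-- The coproduct: `comul f` is the element of `SQSym ⊗ SQSym` that is identified with
`f(x,y;θ,φ)`. -/
noncomputable def comul : SQSym →ₗ[ℚ] SQSym ⊗[ℚ] SQSym :=
  (LinearEquiv.ofInjective tensorToTwo tensorToTwo_injective).symm.toLinearMap ∘ₗ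
    toTwo.codRestrict (LinearMap.range tensorToTwo) toTwo_mem

/-- The defining property of the coproduct. -/
theorem tensorToTwo_comul (f : SQSym) : tensorToTwo (comul f) = twoAlphabets f.1 := by
  have h := (LinearEquiv.ofInjective tensorToTwo tensorToTwo_injective).apply_symm_apply
    (toTwo.codRestrict (LinearMap.range tensorToTwo) toTwo_mem f)
  exact congrArg Subtype.val h

theorem comul_M (α : DottedComp) :
    comul (M α) = ∑ k ∈ Finset.range (α.length + 1), M (α.take k) ⊗ₜ M (α.drop k) :=
  tensorToTwo_injective ((tensorToTwo_comul _).trans (toTwo_M α))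

/-- The part of odd fermionic degree. -/
noncomputable def oddPart : SQSym →ₗ[ℚ] SQSym where
  toFun f := ⟨fun n S => if Odd S.card then f.1 n S else 0, by
    obtain ⟨⟨N, hN⟩, hf⟩ := f.2
    refine ⟨⟨N, fun n S h => by simp [hN n S h]⟩, isQuasisymmetric_of_comp
      (fun α => if Odd (fermionicDegree α) then leadingCoeff f.1 α else 0) fun n S => ?_⟩
    rw [card_comp, hf.coeff_eq]⟩
  map_add' f g := by
    apply Subtype.ext; funext n S
    by_cases h : Odd S.card <;> simp [h]
  map_smul' c f := by
    apply Subtype.ext; funext n S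
    by_cases h : Odd S.card <;> simp [h]

/-- `f` is homogeneous of fermionic degree `a`. -/
def IsFermionic (a : ℕ) (f : SQSym) : Prop := ∀ n S, S.card ≠ a → f.1 n S = 0

theorem oddPart_of_isFermionic {a : ℕ} {f : SQSym} (hf : IsFermionic a f) :
    oddPart f = if Odd a then f else 0 := by
  apply Subtype.ext
  funext n S
  by_cases h : S.card = a
  · subst h
    change (if Odd S.card then f.1 n S else 0) = _
    split_ifs <;> rfl
  · change (if Odd S.card then f.1 n S else 0) = _
    rw [hf n S h]
    split_ifs
    · exact (hf n S h).symm
    · rfl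
    · exact (hf n S h).symm
    · rfl

theorem M_isFermionic (α : DottedComp) : IsFermionic (fermionicDegree α) (M α) := by
  intro n S h
  rw [M_apply, if_neg]
  rintro rfl
  exact h (card_comp n S).symm

end SQSym

namespace SQSym

open SuperSeries DottedComp

/-- The pairing of `F ⊗ G` with tensors `a ⊗ b`, with sign `ε = 1` or `ε = -1`:
`⟨F ⊗ G, a ⊗ b⟩ = ε ^ (deg G * deg a) * ⟨F, a⟩ * ⟨G, b⟩` on homogeneous elements, `deg` being the
fermionic degree. Thus `ε = 1` is the pairing without signs, and `ε = -1` is the pairing formed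
with the twist map `G ⊗ a ↦ (-1) ^ (deg G * deg a) a ⊗ G`.
(Here `G ∘ oddPart` is the part of odd degree of `G`.) -/
noncomputable def pairTensor (ε : ℤˣ) :
    Module.Dual ℚ SQSym ⊗[ℚ] Module.Dual ℚ SQSym →ₗ[ℚ] Module.Dual ℚ (SQSym ⊗[ℚ] SQSym) :=
  TensorProduct.dualDistrib ℚ SQSym SQSym +
    (((ε : ℤ) : ℚ) - 1) • (TensorProduct.dualDistrib ℚ SQSym SQSym ∘ₗ
      TensorProduct.map oddPart.dualMap oddPart.dualMap)

theorem pairTensor_apply (ε : ℤˣ) (F G : Module.Dual ℚ SQSym) (a b : SQSym) :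
    pairTensor ε (F ⊗ₜ G) (a ⊗ₜ b) =
      F a * G b + (((ε : ℤ) : ℚ) - 1) * (F (oddPart a) * G (oddPart b)) := by
  simp [pairTensor]

/-- The sign `ε ^ (a * b)` as a rational number. -/
def koszul (ε : ℤˣ) (a b : ℕ) : ℚ := ((ε ^ (a * b) : ℤˣ) : ℤ)

theorem koszul_eq (ε : ℤˣ) (a b : ℕ) :
    koszul ε a b = if Odd a ∧ Odd b then ((ε : ℤ) : ℚ) else 1 := by
  unfold koszul
  rcases Int.units_eq_one_or ε with rfl | rfl
  · simp
  · split_ifs with h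
    · rw [(Nat.odd_mul.2 h).neg_one_pow]
    · rw [← Nat.odd_mul, Nat.not_odd_iff_even] at h
      rw [h.neg_one_pow]
      simp

/-- The pairing on tensors, for `a` of fermionic degree `i` and `G` of fermionic degree `j`. -/
theorem pairTensor_homogeneous (ε : ℤˣ) (F G : Module.Dual ℚ SQSym) {i j : ℕ} {a : SQSym}
    (ha : IsFermionic i a) (hG : ∀ k b, IsFermionic k b → k ≠ j → G b = 0) (b : SQSym) :
    pairTensor ε (F ⊗ₜ G) (a ⊗ₜ b) = koszul ε j i * (F a * G b) := by
  rw [← basisM.linearCombination_repr b, Finsupp.linearCombination_apply, Finsupp.sum,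
    TensorProduct.tmul_sum, map_sum, map_sum, Finset.mul_sum, Finset.mul_sum]
  refine Finset.sum_congr rfl fun β _ => ?_
  rw [basisM_apply, pairTensor_apply, map_smul, map_smul, map_smul, oddPart_of_isFermionic ha,
    oddPart_of_isFermionic (M_isFermionic β), koszul_eq]
  by_cases hj : fermionicDegree β = j
  · rw [hj]
    by_cases h1 : Odd i <;> by_cases h2 : Odd j <;> simp [h1, h2]
    ring
  · rw [hG _ _ (M_isFermionic β) hj]
    split_ifs <;> simp [hG _ _ (M_isFermionic β) hj]

theorem pairTensor_M (ε : ℤˣ) (F G : Module.Dual ℚ SQSym) (α β : DottedComp) :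
    pairTensor ε (F ⊗ₜ G) (M α ⊗ₜ M β) =
      koszul ε (fermionicDegree α) (fermionicDegree β) * (F (M α) * G (M β)) := by
  rw [pairTensor_apply, oddPart_of_isFermionic (M_isFermionic α),
    oddPart_of_isFermionic (M_isFermionic β), koszul_eq]
  by_cases h1 : Odd (fermionicDegree α) <;> by_cases h2 : Odd (fermionicDegree β) <;>
    simp [h1, h2]
  ring

/-- The graded dual: the linear functionals that vanish on all homogeneous components of
sufficiently large degree (total plus fermionic); equivalently the direct sum of the duals of the
homogeneous components, which are finite dimensional. -/
def gradedDual : Submodule ℚ (Module.Dual ℚ SQSym) where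
  carrier := {F | ∃ N, ∀ f : SQSym, f.1.DegreeGT N → F f = 0}
  zero_mem' := ⟨0, fun _ _ => rfl⟩
  add_mem' := by
    rintro F G ⟨N, hN⟩ ⟨K, hK⟩
    refine ⟨max N K, fun f hf => ?_⟩
    have h1 := hN f fun n S h => hf n S (h.trans (le_max_left _ _))
    have h2 := hK f fun n S h => hf n S (h.trans (le_max_right _ _))
    simp [h1, h2]
  smul_mem' := by
    rintro c F ⟨N, hN⟩
    exact ⟨N, fun f hf => by simp [hN f hf]⟩

theorem M_degreeGT {α : DottedComp} {N : ℕ} (h : N < weight α) : (M α).1.DegreeGT N := by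
  intro n S hn
  rw [M_apply, if_neg]
  rintro rfl
  rw [weight_comp] at h
  omega

theorem mem_gradedDual_iff (F : Module.Dual ℚ SQSym) :
    F ∈ gradedDual ↔ ∃ N, ∀ α, N < weight α → F (M α) = 0 := by
  constructor
  · rintro ⟨N, hN⟩
    exact ⟨N, fun α h => hN _ (M_degreeGT h)⟩
  · rintro ⟨N, hN⟩
    refine ⟨N, fun f hf => ?_⟩
    rw [← basisM.linearCombination_repr f, Finsupp.linearCombination_apply, Finsupp.sum, map_sum]
    refine Finset.sum_eq_zero fun α _ => ?_
    rw [map_smul, basisM_apply]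
    by_cases h : N < weight α
    · rw [hN α h, smul_zero]
    · rw [basisM_repr, leadingCoeff, hf _ _ (by rw [weight_eq]; omega), zero_smul]

theorem oddPart_degreeGT {f : SQSym} {N : ℕ} (hf : f.1.DegreeGT N) :
    (oddPart f).1.DegreeGT N := by
  intro n S h
  change (if Odd S.card then f.1 n S else 0) = 0
  rw [hf n S h]
  simp

end SQSym

/-- Noncommutative symmetric functions in superspace: the graded dual of `SQSym`, with the
structure that is dual to that of `SQSym` for the pairing on tensors with sign `ε`. -/
def SNSym (_ε : ℤˣ) : Type := SQSym.gradedDual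

namespace SNSym

open SQSym SuperSeries DottedComp

noncomputable instance (ε : ℤˣ) : AddCommGroup (SNSym ε) :=
  inferInstanceAs (AddCommGroup SQSym.gradedDual)

noncomputable instance (ε : ℤˣ) : Module ℚ (SNSym ε) :=
  inferInstanceAs (Module ℚ SQSym.gradedDual)

/-- The dual pairing `⟨F, f⟩`, as a functional of `f`. -/
noncomputable def pairing {ε : ℤˣ} : SNSym ε →ₗ[ℚ] Module.Dual ℚ SQSym :=
  SQSym.gradedDual.subtype

theorem ext_M {ε : ℤˣ} {F G : SNSym ε} (h : ∀ α, pairing F (M α) = pairing G (M α)) : F = G := by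
  apply Subtype.ext
  apply basisM.ext
  intro α
  rw [basisM_apply]
  exact h α

theorem exists_bound {ε : ℤˣ} (F : SNSym ε) :
    ∃ N, ∀ f : SQSym, f.1.DegreeGT N → pairing F f = 0 := F.2

theorem pairTensor_comul_M (ε : ℤˣ) (F G : Module.Dual ℚ SQSym) (α : DottedComp) :
    pairTensor ε (F ⊗ₜ G) (comul (M α)) = ∑ k ∈ Finset.range (α.length + 1),
      koszul ε (fermionicDegree (α.take k)) (fermionicDegree (α.drop k)) *
        (F (M (α.take k)) * G (M (α.drop k))) := by
  rw [comul_M, map_sum]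
  exact Finset.sum_congr rfl fun k _ => pairTensor_M ε F G _ _

theorem mul_mem {ε : ℤˣ} (F G : SNSym ε) :
    pairTensor ε (pairing F ⊗ₜ pairing G) ∘ₗ comul ∈ gradedDual := by
  obtain ⟨N, hN⟩ := exists_bound F
  obtain ⟨K, hK⟩ := exists_bound G
  rw [mem_gradedDual_iff]
  refine ⟨N + K, fun α h => ?_⟩
  rw [LinearMap.comp_apply, pairTensor_comul_M]
  refine Finset.sum_eq_zero fun k _ => ?_
  have h1 : weight (α.take k) + weight (α.drop k) = weight α := by
    rw [← weight_append, List.take_append_drop]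
  by_cases h2 : N < weight (α.take k)
  · rw [hN _ (M_degreeGT h2)]; ring
  · rw [hK _ (M_degreeGT (by omega))]; ring

/-- The product, dual to the coproduct of `SQSym`: `⟨F G, a⟩ = ⟨F ⊗ G, Δ a⟩`. -/
noncomputable def mulL (ε : ℤˣ) : SNSym ε →ₗ[ℚ] SNSym ε →ₗ[ℚ] SNSym ε :=
  LinearMap.mk₂ ℚ
    (fun F G => ⟨pairTensor ε (pairing F ⊗ₜ pairing G) ∘ₗ comul, mul_mem F G⟩)
    (fun F F' G => Subtype.ext (by
      change pairTensor ε (pairing (F + F') ⊗ₜ pairing G) ∘ₗ comul =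
        pairTensor ε (pairing F ⊗ₜ pairing G) ∘ₗ comul +
          pairTensor ε (pairing F' ⊗ₜ pairing G) ∘ₗ comul
      rw [map_add, TensorProduct.add_tmul, map_add, LinearMap.add_comp]))
    (fun c F G => Subtype.ext (by
      change pairTensor ε (pairing (c • F) ⊗ₜ pairing G) ∘ₗ comul =
        c • (pairTensor ε (pairing F ⊗ₜ pairing G) ∘ₗ comul)
      rw [map_smul, ← TensorProduct.smul_tmul', map_smul, LinearMap.smul_comp]))
    (fun F G G' => Subtype.ext (by
      change pairTensor ε (pairing F ⊗ₜ pairing (G + G')) ∘ₗ comul =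
        pairTensor ε (pairing F ⊗ₜ pairing G) ∘ₗ comul +
          pairTensor ε (pairing F ⊗ₜ pairing G') ∘ₗ comul
      rw [map_add, TensorProduct.tmul_add, map_add, LinearMap.add_comp]))
    (fun c F G => Subtype.ext (by
      change pairTensor ε (pairing F ⊗ₜ pairing (c • G)) ∘ₗ comul =
        c • (pairTensor ε (pairing F ⊗ₜ pairing G) ∘ₗ comul)
      rw [map_smul, TensorProduct.tmul_smul, map_smul, LinearMap.smul_comp]))

theorem pairing_mulL {ε : ℤˣ} (F G : SNSym ε) (a : SQSym) :
    pairing (mulL ε F G) a = pairTensor ε (pairing F ⊗ₜ pairing G) (comul a) := rfl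

/-- The element `H_α` of the basis dual to the monomial quasisymmetric functions: `⟨H_α, f⟩` is
the coefficient of `M_α` in `f`. -/
noncomputable def H (ε : ℤˣ) (α : DottedComp) : SNSym ε :=
  ⟨basisM.coord α, (mem_gradedDual_iff _).2 ⟨weight α, fun β h => by
    rw [Module.Basis.coord_apply, basisM_repr, lead_M, if_neg]
    rintro rfl
    exact lt_irrefl _ h⟩⟩

theorem pairing_H {ε : ℤˣ} (α β : DottedComp) :
    pairing (H ε α) (M β) = if α = β then 1 else 0 := by
  change basisM.coord α (M β) = _
  rw [Module.Basis.coord_apply, basisM_repr, lead_M]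

theorem span_H (ε : ℤˣ) : (⊤ : Submodule ℚ (SNSym ε)) ≤ Submodule.span ℚ (Set.range (H ε)) := by
  intro F _
  obtain ⟨N, hN⟩ := exists_bound F
  have : F = ∑ α ∈ (finite_weight_le N).toFinset, pairing F (M α) • H ε α := by
    apply ext_M
    intro β
    rw [map_sum, LinearMap.sum_apply]
    simp only [map_smul, LinearMap.smul_apply, pairing_H, smul_eq_mul, mul_ite, mul_one, mul_zero]
    rw [Finset.sum_ite_eq']
    split_ifs with h
    · rfl
    · apply hN
      apply M_degreeGT
      simpa using h
  rw [this]
  exact Submodule.sum_mem _ fun α _ => Submodule.smul_mem _ _ (Submodule.subset_span ⟨α, rfl⟩)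

theorem linearIndependent_H (ε : ℤˣ) : LinearIndependent ℚ (H ε) := by
  rw [linearIndependent_iff]
  intro c hc
  ext β
  have h := congrArg (fun F => pairing F (M β)) hc
  simp only [Finsupp.linearCombination_apply, Finsupp.sum, map_sum, LinearMap.sum_apply, map_smul,
    LinearMap.smul_apply, pairing_H, smul_eq_mul, mul_ite, mul_one, mul_zero, map_zero,
    LinearMap.zero_apply] at h
  rw [Finset.sum_ite_eq'] at h
  simpa using h

/-- The `H_α` form a basis. -/
noncomputable def basisH (ε : ℤˣ) : Module.Basis DottedComp ℚ (SNSym ε) :=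
  .mk (linearIndependent_H ε) (span_H ε)

theorem basisH_apply (ε : ℤˣ) (α : DottedComp) : basisH ε α = H ε α := by
  rw [basisH, Module.Basis.mk_apply]

theorem mulL_H (ε : ℤˣ) (β γ : DottedComp) : mulL ε (H ε β) (H ε γ) =
    koszul ε (fermionicDegree β) (fermionicDegree γ) • H ε (β ++ γ) := by
  apply ext_M
  intro α
  have h := sum_take_drop α β γ fun β γ => koszul ε (fermionicDegree β) (fermionicDegree γ)
  rw [pairing_mulL, pairTensor_comul_M, map_smul, LinearMap.smul_apply, pairing_H]
  simp only [pairing_H, smul_eq_mul, mul_ite, mul_one, mul_zero]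
  rw [← h]
  refine Finset.sum_congr rfl fun k _ => ?_
  by_cases h1 : β = α.take k
  · by_cases h2 : γ = α.drop k
    · simp only [if_pos h1, if_pos h2, one_mul]
    · simp only [if_neg h2, mul_zero, zero_mul]
  · simp only [if_neg h1, zero_mul, ite_self]

theorem fermionicDegree_append (α β : DottedComp) :
    fermionicDegree (α ++ β) = fermionicDegree α + fermionicDegree β := by
  simp [fermionicDegree]

theorem koszul_assoc (ε : ℤˣ) (a b c : ℕ) :
    koszul ε a b * koszul ε (a + b) c = koszul ε b c * koszul ε a (b + c) := by
  unfold koszul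
  norm_cast
  rw [← pow_add, ← pow_add]
  congr 1
  ring_nf

theorem induction_H {ε : ℤˣ} {p : SNSym ε → Prop} (F : SNSym ε) (h : ∀ α, p (H ε α))
    (h_add : ∀ F G, p F → p G → p (F + G)) (h_smul : ∀ (c : ℚ) F, p F → p (c • F)) : p F := by
  have h_zero : p 0 := by simpa using h_smul 0 _ (h [])
  refine Submodule.span_induction (p := fun F _ => p F) ?_ h_zero (fun F G _ _ => h_add F G)
    (fun c F _ => h_smul c F) (span_H ε (Submodule.mem_top (x := F)))
  rintro _ ⟨α, rfl⟩
  exact h α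

theorem mulL_assoc (ε : ℤˣ) (F G K : SNSym ε) :
    mulL ε (mulL ε F G) K = mulL ε F (mulL ε G K) := by
  induction F using induction_H with
  | h α =>
    induction G using induction_H with
    | h β =>
      induction K using induction_H with
      | h γ =>
        rw [mulL_H, mulL_H, map_smul, map_smul, LinearMap.smul_apply, mulL_H, mulL_H, smul_smul,
          smul_smul, fermionicDegree_append, fermionicDegree_append, koszul_assoc,
          List.append_assoc]
      | h_add F G hF hG => simp only [map_add, hF, hG]
      | h_smul c F hF => simp only [map_smul, hF]
    | h_add F G hF hG => simp only [map_add, LinearMap.add_apply, hF, hG]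
    | h_smul c F hF => simp only [map_smul, LinearMap.smul_apply, hF]
  | h_add F G hF hG => simp only [map_add, LinearMap.add_apply, hF, hG]
  | h_smul c F hF => simp only [map_smul, LinearMap.smul_apply, hF]

/-- The unit, dual to the counit of `SQSym` (the constant term): `⟨1, f⟩` is the constant term of
`f`. -/
noncomputable def unit (ε : ℤˣ) : SNSym ε :=
  ⟨{ toFun := fun f => f.1 0 ∅, map_add' := fun _ _ => rfl, map_smul' := fun _ _ => rfl },
    ⟨0, fun f hf => hf 0 ∅ (by simp)⟩⟩

theorem unit_eq (ε : ℤˣ) : unit ε = H ε [] := by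
  apply ext_M
  intro α
  rw [pairing_H]
  change (M α).1 0 ∅ = _
  rw [M_apply]
  have : comp 0 ∅ = [] := by simp [comp]
  rw [this]

noncomputable instance (ε : ℤˣ) : Ring (SNSym ε) :=
  { (inferInstance : AddCommGroup (SNSym ε)) with
    mul := fun F G => mulL ε F G
    one := unit ε
    mul_assoc := mulL_assoc ε
    left_distrib := fun F G K => map_add (mulL ε F) G K
    right_distrib := fun F G K => (mulL ε).map_add₂ F G K
    zero_mul := fun F => (mulL ε).map_zero₂ F
    mul_zero := fun F => map_zero (mulL ε F)
    one_mul := fun F => by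
      change mulL ε (unit ε) F = F
      rw [unit_eq]
      induction F using induction_H with
      | h α => rw [mulL_H]; simp [koszul, fermionicDegree]
      | h_add F G hF hG => rw [map_add, hF, hG]
      | h_smul c F hF => rw [map_smul, hF]
    mul_one := fun F => by
      change mulL ε F (unit ε) = F
      rw [unit_eq]
      induction F using induction_H with
      | h α => rw [mulL_H]; simp [koszul, fermionicDegree]
      | h_add F G hF hG => rw [map_add, LinearMap.add_apply, hF, hG]
      | h_smul c F hF => rw [map_smul, LinearMap.smul_apply, hF] }

noncomputable instance (ε : ℤˣ) : Algebra ℚ (SNSym ε) :=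
  Algebra.ofModule (fun c F G => (mulL ε).map_smul₂ c F G) (fun c F G => map_smul (mulL ε F) c G)

/-- The defining property of the product: `⟨F G, a⟩ = ⟨F ⊗ G, Δ a⟩`. -/
theorem pairing_mul {ε : ℤˣ} (F G : SNSym ε) (a : SQSym) :
    pairing (F * G) a = pairTensor ε (pairing F ⊗ₜ pairing G) (comul a) := rfl

/-- The pairing between `SNSym ⊗ SNSym` and `SQSym ⊗ SQSym`. -/
noncomputable def pairing₂ (ε : ℤˣ) :
    SNSym ε ⊗[ℚ] SNSym ε →ₗ[ℚ] Module.Dual ℚ (SQSym ⊗[ℚ] SQSym) :=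
  pairTensor ε ∘ₗ TensorProduct.map pairing pairing

theorem koszul_mul_self (ε : ℤˣ) (a b : ℕ) : koszul ε a b * koszul ε a b = 1 := by
  unfold koszul
  norm_cast
  rw [Int.units_mul_self]
  rfl

theorem pairing₂_injective (ε : ℤˣ) : Function.Injective (pairing₂ ε) := by
  have key : ∀ (t : SNSym ε ⊗[ℚ] SNSym ε) (α β : DottedComp),
      pairing₂ ε t (M α ⊗ₜ M β) = koszul ε (fermionicDegree α) (fermionicDegree β) *
        ((basisH ε).tensorProduct (basisH ε)).repr t (α, β) := by
    intro t α β
    have hrepr : ∀ (F : SNSym ε) (α : DottedComp), (basisH ε).repr F α = pairing F (M α) := by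
      intro F α
      induction F using induction_H with
      | h γ =>
        rw [pairing_H, ← basisH_apply, Module.Basis.repr_self, Finsupp.single_apply]
      | h_add F G hF hG => simp only [map_add, Finsupp.add_apply, LinearMap.add_apply, hF, hG]
      | h_smul c F hF => simp only [map_smul, Finsupp.smul_apply, LinearMap.smul_apply, hF]
    induction t using TensorProduct.induction_on with
    | zero => simp
    | tmul F G =>
      rw [pairing₂, LinearMap.comp_apply, TensorProduct.map_tmul, pairTensor_M,
        Module.Basis.tensorProduct_repr_tmul_apply, hrepr, hrepr, smul_eq_mul,
        mul_comm (pairing G _)]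
    | add s t hs ht =>
      simp only [map_add, Finsupp.add_apply, LinearMap.add_apply, hs, ht, mul_add]
  intro t t' h
  apply ((basisH ε).tensorProduct (basisH ε)).repr.injective
  ext ⟨α, β⟩
  have h1 := key t α β
  rw [h, key t' α β] at h1
  have h2 := congrArg (koszul ε (fermionicDegree α) (fermionicDegree β) * ·) h1
  simp only [← mul_assoc, koszul_mul_self, one_mul] at h2
  exact h2.symm

/-- The functional `a ⊗ b ↦ ⟨F, a b⟩`. -/
noncomputable def pairingMul (ε : ℤˣ) : SNSym ε →ₗ[ℚ] Module.Dual ℚ (SQSym ⊗[ℚ] SQSym) :=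
  (TensorProduct.lift SQSym.mulL).dualMap ∘ₗ pairing

theorem pairingMul_mem (ε : ℤˣ) (F : SNSym ε) :
    pairingMul ε F ∈ LinearMap.range (pairing₂ ε) := by
  obtain ⟨N, hN⟩ := exists_bound F
  refine ⟨∑ α ∈ (finite_weight_le N).toFinset, ∑ β ∈ (finite_weight_le N).toFinset,
    (koszul ε (fermionicDegree α) (fermionicDegree β) * pairing F (SQSym.mulL (M α) (M β))) •
      (H ε α ⊗ₜ H ε β), ?_⟩
  apply (basisM.tensorProduct basisM).ext
  rintro ⟨α, β⟩
  rw [Module.Basis.tensorProduct_apply, basisM_apply, basisM_apply, map_sum, LinearMap.sum_apply]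
  simp only [map_sum, map_smul, LinearMap.sum_apply, LinearMap.smul_apply, pairing₂,
    LinearMap.comp_apply, TensorProduct.map_tmul, pairTensor_M, pairing_H, smul_eq_mul]
  change _ = pairing F (SQSym.mulL (M α) (M β))
  rw [Finset.sum_eq_single α, Finset.sum_eq_single β]
  · simp only [if_true, mul_one]
    rw [mul_right_comm, koszul_mul_self, one_mul]
  · intro γ _ h
    simp [h]
  · intro h
    rw [hN (SQSym.mulL (M α) (M β))]
    · simp
    · apply DegreeGT.mul_right
      apply M_degreeGT
      simpa using h
  · intro γ _ h
    simp [h]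
  · intro h
    rw [Finset.sum_eq_single β]
    · rw [hN (SQSym.mulL (M α) (M β))]
      · simp
      · apply DegreeGT.mul_left
        apply M_degreeGT
        simpa using h
    · intro γ _ h
      simp [h]
    · intro h
      rw [hN (SQSym.mulL (M α) (M β))]
      · simp
      · apply DegreeGT.mul_right
        apply M_degreeGT
        simpa using h

/-- The coproduct, dual to the product of `SQSym`: `⟨Δ F, a ⊗ b⟩ = ⟨F, a b⟩`. -/
noncomputable def comul (ε : ℤˣ) : SNSym ε →ₗ[ℚ] SNSym ε ⊗[ℚ] SNSym ε :=
  (LinearEquiv.ofInjective (pairing₂ ε) (pairing₂_injective ε)).symm.toLinearMap ∘ₗ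
    (pairingMul ε).codRestrict (LinearMap.range (pairing₂ ε)) (pairingMul_mem ε)

/-- The defining property of the coproduct. -/
theorem pairing₂_comul {ε : ℤˣ} (F : SNSym ε) (a b : SQSym) :
    pairing₂ ε (comul ε F) (a ⊗ₜ b) = pairing F (SQSym.mulL a b) := by
  have h := (LinearEquiv.ofInjective (pairing₂ ε) (pairing₂_injective ε)).apply_symm_apply
    ((pairingMul ε).codRestrict (LinearMap.range (pairing₂ ε)) (pairingMul_mem ε) F)
  exact LinearMap.congr_fun (congrArg Subtype.val h) (a ⊗ₜ b)

/-- The part of odd fermionic degree: `⟨oddPart F, f⟩ = ⟨F, oddPart f⟩`. -/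
noncomputable def oddPart (ε : ℤˣ) : SNSym ε →ₗ[ℚ] SNSym ε where
  toFun F := ⟨pairing F ∘ₗ SQSym.oddPart, by
    obtain ⟨N, hN⟩ := exists_bound F
    exact ⟨N, fun f hf => hN _ (oddPart_degreeGT hf)⟩⟩
  map_add' _ _ := rfl
  map_smul' _ _ := rfl

/-- The product of `SNSym ⊗ SNSym` as a tensor product of superalgebras:
`(F₁ ⊗ G₁) (F₂ ⊗ G₂) = (-1) ^ (deg G₁ * deg F₂) F₁ F₂ ⊗ G₁ G₂` on homogeneous elements. -/
noncomputable def superMul (ε : ℤˣ) :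
    SNSym ε ⊗[ℚ] SNSym ε →ₗ[ℚ] SNSym ε ⊗[ℚ] SNSym ε →ₗ[ℚ] SNSym ε ⊗[ℚ] SNSym ε :=
  TensorProduct.map₂ (mulL ε) (mulL ε) -
    (2 : ℚ) • TensorProduct.map₂ ((mulL ε).compl₂ (oddPart ε)) (mulL ε ∘ₗ oddPart ε)

theorem superMul_tmul {ε : ℤˣ} (F₁ G₁ F₂ G₂ : SNSym ε) :
    superMul ε (F₁ ⊗ₜ G₁) (F₂ ⊗ₜ G₂) = (F₁ * F₂) ⊗ₜ (G₁ * G₂) -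
      (2 : ℚ) • ((F₁ * oddPart ε F₂) ⊗ₜ (oddPart ε G₁ * G₂)) := rfl

/-- `F` is homogeneous of fermionic degree `a`. -/
def IsFermionic {ε : ℤˣ} (a : ℕ) (F : SNSym ε) : Prop :=
  ∀ k (f : SQSym), SQSym.IsFermionic k f → k ≠ a → pairing F f = 0

theorem oddPart_of_isFermionic {ε : ℤˣ} {a : ℕ} {F : SNSym ε} (hF : IsFermionic a F) :
    oddPart ε F = if Odd a then F else 0 := by
  apply ext_M
  intro α
  change pairing F (SQSym.oddPart (M α)) = _
  rw [SQSym.oddPart_of_isFermionic (M_isFermionic α)]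
  by_cases h : fermionicDegree α = a
  · rw [h]
    split_ifs <;> simp
  · have h1 := hF _ _ (M_isFermionic α) h
    split_ifs <;> simp [h1]

theorem superMul_homogeneous {ε : ℤˣ} {a b : ℕ} (F₁ : SNSym ε) {G₁ F₂ : SNSym ε} (G₂ : SNSym ε)
    (hG : IsFermionic a G₁) (hF : IsFermionic b F₂) :
    superMul ε (F₁ ⊗ₜ G₁) (F₂ ⊗ₜ G₂) =
      (-1 : ℚ) ^ (a * b) • ((F₁ * F₂) ⊗ₜ[ℚ] (G₁ * G₂)) := by
  rw [superMul_tmul, oddPart_of_isFermionic hG, oddPart_of_isFermionic hF]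
  by_cases h : Odd (a * b)
  · rw [h.neg_one_pow, if_pos (Nat.odd_mul.1 h).1, if_pos (Nat.odd_mul.1 h).2]
    module
  · rw [(Nat.not_odd_iff_even.1 h).neg_one_pow]
    rw [Nat.odd_mul, not_and_or] at h
    rcases h with h | h <;> simp [h]

/-- The element `H_m`, dual to `M_{(m)}`, for `m ≥ 1`; and `H_0 = 1`. -/
noncomputable def Heven (ε : ℤˣ) (m : ℕ) : SNSym ε :=
  if h : 0 < m then H ε [.plain ⟨m, h⟩] else 1

/-- The element `H̃_n`, dual to `M_α` for `α` with the single dotted part `n ≥ 0`. -/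
noncomputable def Hodd (ε : ℤˣ) (n : ℕ) : SNSym ε := H ε [.dotted n]

end SNSym

namespace SuperSeries

open DottedComp Finset

/-! ### Substituting two alphabets is multiplicative -/

/-! Everything is read off by duality. Substituting two ordered alphabets cuts a monomial at the
border between them, so `Δ M_α` is the sum over all deconcatenations of `α`. Dually, `H_β H_γ` is
`H_{βγ}` up to the sign `ε ^ (m_β m_γ)` (`mulL_H`). Splitting off one part at a time, each pair of
dotted parts contributes one factor `ε`, which gives `ε ^ (m_α choose 2)` (`H_eq_prod`). These signs
are invertible and words in the parts are exactly dotted compositions, so the word basis of the free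
algebra goes to a rescaled basis of the dual (`ofFree_bijective`).

The generators are the functionals reading off the coefficients of the one-variable monomials
`x_0^n` and `θ_0 x_0^n` (`pairing_H_comp`). Their coproducts therefore list the ways in which such a
monomial arises in a product of two series: the exponent is shared out, and a single `θ_0` comes
from one factor or the other.

Multiplicativity of the dual coproduct amounts to multiplicativity of the coproduct of `SQSym`. That
is the fact that substitution of two alphabets respects products, where moving the `φ`'s of the
first factor past the `θ`'s of the second produces the super sign (`twoAlphabets_mul`,
`comul_mulL`). Transporting it through the pairing introduces powers of `ε`, which agree on both
sides by `shuffleSign_mul`; hence the same formula holds for both values of `ε`. -/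

theorem sign_eq_prod (A B : Finset ℕ) :
    sign A B = ∏ p ∈ A ×ˢ B, if p.2 < p.1 then (-1 : ℚ) else 1 := by
  rw [sign, Finset.prod_ite, prod_const, prod_const_one, mul_one]

theorem sign_union_left {A A' : Finset ℕ} (h : Disjoint A A') (B : Finset ℕ) :
    sign (A ∪ A') B = sign A B * sign A' B := by
  simp only [sign_eq_prod, prod_product]
  exact prod_union h

theorem sign_union_right (A : Finset ℕ) {B B' : Finset ℕ} (h : Disjoint B B') :
    sign A (B ∪ B') = sign A B * sign A B' := by
  simp only [sign_eq_prod, prod_product_right]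
  exact prod_union h

theorem sign_of_lt {A B : Finset ℕ} (h : ∀ a ∈ A, ∀ b ∈ B, a < b) : sign A B = 1 := by
  rw [sign_eq_prod]
  refine prod_eq_one fun p hp => if_neg ?_
  rw [mem_product] at hp
  exact (h _ hp.1 _ hp.2).not_gt

theorem sign_of_gt {A B : Finset ℕ} (h : ∀ a ∈ A, ∀ b ∈ B, b < a) :
    sign A B = (-1) ^ (A.card * B.card) := by
  rw [sign_eq_prod, prod_congr rfl (g := fun _ => (-1 : ℚ)), prod_const, card_product]
  intro p hp
  rw [mem_product] at hp
  exact if_pos (h _ hp.1 _ hp.2)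

theorem strictMono_add_left (K : ℕ) : StrictMono (K + ·) := fun _ _ h => Nat.add_lt_add_left h K

theorem disjoint_image_add {K : ℕ} {A : Finset ℕ} (hA : ∀ a ∈ A, a < K) (B : Finset ℕ) :
    Disjoint A (B.image (K + ·)) := by
  rw [disjoint_left]
  intro a ha hb
  obtain ⟨b, _, rfl⟩ := mem_image.1 hb
  have := hA _ ha
  omega

/-- The inversions fall into four blocks. The shifted `B` lies entirely above `A'`, so all pairs are
inverted; `A` lies entirely below the shifted `B'`, so none are; the other two blocks keep their
signs. This is the reordering of `θ_A φ_B θ_{A'} φ_{B'}`. -/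
theorem sign_shift {K : ℕ} {A A' : Finset ℕ} (hA : ∀ a ∈ A, a < K) (hA' : ∀ a ∈ A', a < K)
    (B B' : Finset ℕ) :
    sign (A ∪ B.image (K + ·)) (A' ∪ B'.image (K + ·)) =
      (-1) ^ (B.card * A'.card) * (sign A A' * sign B B') := by
  rw [sign_union_left (disjoint_image_add hA B), sign_union_right _ (disjoint_image_add hA' B'),
    sign_union_right _ (disjoint_image_add hA' B'), sign_image (strictMono_add_left K),
    sign_of_lt (A := A) (B := B'.image (K + ·)), sign_of_gt (A := B.image (K + ·)),
    card_image_of_injective _ (strictMono_add_left K).injective]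
  · ring
  · intro a ha b hb
    obtain ⟨c, _, rfl⟩ := mem_image.1 ha
    have := hA' _ hb
    omega
  · intro a ha b hb
    obtain ⟨c, _, rfl⟩ := mem_image.1 hb
    have := hA _ ha
    omega

/-! ### Splitting exponent vectors and index sets at the border of the alphabets -/

theorem mapDomain_add_apply_of_lt (m : ℕ →₀ ℕ) {K j : ℕ} (h : j < K) :
    m.mapDomain (K + ·) j = 0 := by
  apply Finsupp.mapDomain_of_notMem_range
  rintro ⟨k, hk⟩
  simp only at hk
  omega

theorem mapDomain_add_apply (m : ℕ →₀ ℕ) (K j : ℕ) : m.mapDomain (K + ·) (K + j) = m j :=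
  Finsupp.mapDomain_apply (strictMono_add_left K).injective m j

theorem apply_eq_zero_of_le {n : ℕ →₀ ℕ} {K : ℕ} (hn : ∀ j ∈ n.support, j < K) {j : ℕ}
    (h : K ≤ j) : n j = 0 := by
  by_contra hj
  exact absurd (hn j (Finsupp.mem_support_iff.2 hj)) h.not_gt

/-- Two exponent vectors on the shifted and unshifted variables are determined by their sum. -/
theorem ext_shift {P Q : ℕ →₀ ℕ} {K : ℕ} (h1 : ∀ j, j < K → P j = Q j)
    (h2 : ∀ j, P (K + j) = Q (K + j)) : P = Q := by
  ext j
  rcases lt_or_ge j K with h | h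
  · exact h1 j h
  · obtain ⟨k, rfl⟩ := Nat.exists_eq_add_of_le h
    exact h2 k

/-- The exponents below `K` and those from `K` on can be decomposed independently, since `n` lives
below `K` and the shifted `m` from `K` on. The inverse bijection restricts to the indices below `K`
and pulls the rest back along the shift. -/
theorem sum_antidiagonal_shift {K : ℕ} {n : ℕ →₀ ℕ} (hn : ∀ j ∈ n.support, j < K) (m : ℕ →₀ ℕ)
    (c : (ℕ →₀ ℕ) → (ℕ →₀ ℕ) → ℚ) :
    ∑ P ∈ HasAntidiagonal.antidiagonal (n + m.mapDomain (K + ·)), c P.1 P.2 =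
      ∑ p ∈ HasAntidiagonal.antidiagonal n, ∑ q ∈ HasAntidiagonal.antidiagonal m,
        c (p.1 + q.1.mapDomain (K + ·)) (p.2 + q.2.mapDomain (K + ·)) := by
  rw [← sum_product']
  symm
  have hinj : Function.Injective (K + ·) := (strictMono_add_left K).injective
  refine sum_nbij'
    (fun r => (r.1.1 + r.2.1.mapDomain (K + ·), r.1.2 + r.2.2.mapDomain (K + ·)))
    (fun P => ((P.1.filter (· < K), P.2.filter (· < K)),
      (P.1.comapDomain (K + ·) hinj.injOn, P.2.comapDomain (K + ·) hinj.injOn))) ?_ ?_ ?_ ?_ ?_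
  · rintro ⟨⟨p, p'⟩, q, q'⟩ h
    simp only [mem_product, HasAntidiagonal.mem_antidiagonal] at h ⊢
    rw [← h.1, ← h.2, Finsupp.mapDomain_add]
    abel
  · rintro ⟨P, P'⟩ h
    simp only [mem_product, HasAntidiagonal.mem_antidiagonal] at h ⊢
    constructor
    · apply ext_shift (K := K)
      · intro j hj
        have := DFunLike.congr_fun h j
        rw [Finsupp.add_apply, Finsupp.add_apply, mapDomain_add_apply_of_lt _ hj] at this
        simp only [Finsupp.add_apply, Finsupp.filter_apply, if_pos hj]
        omega
      · intro j
        simp [apply_eq_zero_of_le hn (Nat.le_add_right K j)]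
    · ext j
      have := DFunLike.congr_fun h (K + j)
      rw [Finsupp.add_apply, Finsupp.add_apply, mapDomain_add_apply,
        apply_eq_zero_of_le hn (Nat.le_add_right K j)] at this
      simp only [Finsupp.add_apply, Finsupp.comapDomain_apply]
      omega
  · rintro ⟨⟨p, p'⟩, q, q'⟩ h
    simp only [mem_product, HasAntidiagonal.mem_antidiagonal] at h
    -- A summand of `n` also vanishes from index `K` on, so cutting at `K` recovers both pieces.
    have key : ∀ p q : ℕ →₀ ℕ, p ≤ n →
        (p + q.mapDomain (K + ·)).filter (· < K) = p ∧
        (p + q.mapDomain (K + ·)).comapDomain (K + ·) hinj.injOn = q := by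
      intro p q hp
      have hz : ∀ j, p (K + j) = 0 := fun j => Nat.le_zero.1
        ((hp _).trans (apply_eq_zero_of_le hn (Nat.le_add_right K j)).le)
      constructor
      · apply ext_shift (K := K)
        · intro j hj
          simp [hj, mapDomain_add_apply_of_lt _ hj]
        · intro j
          simp [hz]
      · ext j
        simp [hz, mapDomain_add_apply]
    obtain ⟨h1, h2⟩ := key p q (h.1 ▸ le_self_add)
    obtain ⟨h3, h4⟩ := key p' q' (h.1 ▸ le_add_self)
    simp only [h1, h2, h3, h4]
  · rintro ⟨P, P'⟩ _
    have key : ∀ P : ℕ →₀ ℕ, P.filter (· < K) +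
        (P.comapDomain (K + ·) hinj.injOn).mapDomain (K + ·) = P := by
      intro P
      apply ext_shift (K := K)
      · intro j hj
        simp [hj, mapDomain_add_apply_of_lt _ hj]
      · intro j
        simp [mapDomain_add_apply]
    simp only [key]
  · intro _ _
    rfl

/-- A subset of the disjoint union is a choice of one subset in each alphabet, and complements split
in the same way. The summand takes the complement as a separate argument because the sign of a
product depends on both halves. -/
theorem sum_powerset_shift {K : ℕ} {A : Finset ℕ} (hA : ∀ a ∈ A, a < K) (B : Finset ℕ)
    (c : Finset ℕ → Finset ℕ → ℚ) :
    ∑ C ∈ (A ∪ B.image (K + ·)).powerset, c C ((A ∪ B.image (K + ·)) \ C) =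
      ∑ C ∈ A.powerset, ∑ D ∈ B.powerset,
        c (C ∪ D.image (K + ·)) ((A \ C) ∪ (B \ D).image (K + ·)) := by
  have hA' : ∀ j, K + j ∉ A := fun j h => absurd (hA _ h) (by omega)
  rw [← sum_product' A.powerset B.powerset fun C D =>
    c (C ∪ D.image (K + ·)) ((A \ C) ∪ (B \ D).image (K + ·))]
  symm
  refine sum_nbij' (fun r => r.1 ∪ r.2.image (K + ·))
    (fun C => (C.filter (· < K), B.filter (K + · ∈ C))) ?_ ?_ ?_ ?_ ?_
  · rintro ⟨C, D⟩ h
    simp only [mem_product, mem_powerset] at h ⊢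
    exact union_subset_union h.1 (image_subset_image h.2)
  · intro C h
    simp only [mem_product, mem_powerset] at h ⊢
    refine ⟨fun j hj => ?_, filter_subset _ _⟩
    rw [mem_filter] at hj
    rcases mem_union.1 (h hj.1) with h1 | h1
    · exact h1
    · obtain ⟨k, _, rfl⟩ := mem_image.1 h1
      omega
  · rintro ⟨C, D⟩ h
    simp only [mem_product, mem_powerset] at h
    refine Prod.ext ?_ ?_
    · ext j
      simp only [mem_filter, mem_union, mem_image]
      constructor
      · rintro ⟨h1 | ⟨k, _, rfl⟩, h2⟩
        · exact h1
        · omega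
      · intro h1
        exact ⟨Or.inl h1, hA _ (h.1 h1)⟩
    · ext j
      simp only [mem_filter, mem_union, mem_image, Nat.add_left_cancel_iff, exists_eq_right]
      constructor
      · rintro ⟨_, h1 | h1⟩
        · exact absurd (h.1 h1) (hA' j)
        · exact h1
      · intro h1
        exact ⟨h.2 h1, Or.inr h1⟩
  · intro C h
    rw [mem_powerset] at h
    ext j
    simp only [mem_filter, mem_union, mem_image]
    constructor
    · rintro (h1 | ⟨k, h1, rfl⟩)
      · exact h1.1
      · exact h1.2
    · intro hj
      rcases mem_union.1 (h hj) with h1 | h1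
      · exact Or.inl ⟨hj, hA _ h1⟩
      · obtain ⟨k, hk, rfl⟩ := mem_image.1 h1
        exact Or.inr ⟨k, ⟨hk, hj⟩, rfl⟩
  · rintro ⟨C, D⟩ h
    simp only [mem_product, mem_powerset] at h
    congr 1
    ext j
    simp only [mem_union, mem_sdiff, mem_image, not_or, not_exists, not_and]
    constructor
    · rintro (⟨h1, h2⟩ | ⟨k, ⟨h1, h2⟩, rfl⟩)
      · refine ⟨Or.inl h1, h2, ?_⟩
        rintro k _ rfl
        exact hA' k h1
      · refine ⟨Or.inr ⟨k, h1, rfl⟩, fun h3 => hA' k (h.1 h3), fun l hl h3 => h2 ?_⟩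
        rwa [← Nat.add_left_cancel h3]
    · rintro ⟨h1 | ⟨k, h1, rfl⟩, h2, h3⟩
      · exact Or.inl ⟨h1, h2⟩
      · exact Or.inr ⟨k, ⟨h1, fun h4 => h3 k h4 rfl⟩, rfl⟩

/-- The substitution of two alphabets does not depend on the number of variables in the first. -/
theorem IsQuasisymmetric.twoAlphabets_eq {f : SuperSeries} (hf : f.IsQuasisymmetric) {K : ℕ}
    {n : ℕ →₀ ℕ} {A : Finset ℕ} (hn : ∀ j ∈ n.support, j < K) (hA : ∀ a ∈ A, a < K)
    (m : ℕ →₀ ℕ) (B : Finset ℕ) :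
    f (n + m.mapDomain (K + ·)) (A ∪ B.image (K + ·)) = twoAlphabets f n A m B := by
  have hK : indexBound n A ≤ K := by
    refine Finset.sup_le fun j hj => ?_
    rcases mem_union.1 hj with h | h
    · exact hn j h
    · exact hA j h
  have hlt := fun j => lt_indexBound (n := n) (A := A) (j := j)
  rw [twoAlphabets]
  generalize indexBound n A = k at *
  obtain ⟨d, rfl⟩ := Nat.exists_eq_add_of_le hK
  -- This map opens a gap of `d` unused indices at the border `k`. It fixes `θ_A x^n` and turns the
  -- shift by `k` into the shift by `k + d`, so quasisymmetry identifies the two coefficients.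
  have he : StrictMono fun j => if j < k then j else j + d := by
    intro a b hab
    simp only
    split_ifs <;> omega
  have hcomp : ((fun j => if j < k then j else j + d) ∘ (k + ·)) = (k + d + ·) := by
    funext j
    simp only [Function.comp]
    rw [if_neg (by omega)]
    omega
  rw [← hf.map_eq he (n + m.mapDomain (k + ·)), Finsupp.mapDomain_add, ← Finsupp.mapDomain_comp, image_union, image_image,
    hcomp]
  congr 2
  · conv_lhs => rw [← Finsupp.mapDomain_id (v := n)]
    exact Finsupp.mapDomain_congr fun j hj => (if_pos (hlt j (mem_union_left _ hj))).symm
  · conv_lhs => rw [← image_id (s := A)]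
    exact image_congr fun j hj => (if_pos (hlt j (mem_union_right _ hj))).symm

/-- Both factors are cut at the border chosen for the product, which may exceed the border that
`twoAlphabets` would choose for the factor's own monomial; `twoAlphabets_eq` makes this harmless.
The sign `(-1) ^ (D.card * (A \ C).card)` comes from moving `φ_D` past `θ_{A \ C}`, by `sign_shift`.
-/
theorem twoAlphabets_mul {f g : SuperSeries} (hf : f.IsQuasisymmetric) (hg : g.IsQuasisymmetric)
    (n : ℕ →₀ ℕ) (A : Finset ℕ) (m : ℕ →₀ ℕ) (B : Finset ℕ) :
    twoAlphabets (mul f g) n A m B =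
      ∑ p ∈ HasAntidiagonal.antidiagonal n, ∑ q ∈ HasAntidiagonal.antidiagonal m,
        ∑ C ∈ A.powerset, ∑ D ∈ B.powerset,
          (-1) ^ (D.card * (A \ C).card) * (sign C (A \ C) * sign D (B \ D)) *
            (twoAlphabets f p.1 C q.1 D * twoAlphabets g p.2 (A \ C) q.2 (B \ D)) := by
  rw [twoAlphabets]
  have hn : ∀ j ∈ n.support, j < indexBound n A :=
    fun j hj => lt_indexBound (mem_union_left _ hj)
  have hA : ∀ j ∈ A, j < indexBound n A := fun j hj => lt_indexBound (mem_union_right _ hj)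
  generalize indexBound n A = K at *
  rw [mul, sum_antidiagonal_shift hn m fun P Q => ∑ C ∈ (A ∪ B.image (K + ·)).powerset,
    sign C ((A ∪ B.image (K + ·)) \ C) * (f P C * g Q ((A ∪ B.image (K + ·)) \ C))]
  refine sum_congr rfl fun p hp => sum_congr rfl fun q _ => ?_
  rw [sum_powerset_shift hA B fun C D => sign C D *
    (f (p.1 + q.1.mapDomain (K + ·)) C * g (p.2 + q.2.mapDomain (K + ·)) D)]
  refine sum_congr rfl fun C hC => sum_congr rfl fun D _ => ?_
  rw [HasAntidiagonal.mem_antidiagonal] at hp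
  rw [mem_powerset] at hC
  have hC1 : ∀ a ∈ C, a < K := fun a ha => hA a (hC ha)
  have hC2 : ∀ a ∈ A \ C, a < K := fun a ha => hA a (sdiff_subset ha)
  have hp1 : ∀ j ∈ p.1.support, j < K :=
    fun j hj => hn j (Finsupp.support_mono (hp ▸ le_self_add) hj)
  have hp2 : ∀ j ∈ p.2.support, j < K :=
    fun j hj => hn j (Finsupp.support_mono (hp ▸ le_add_self) hj)
  rw [sign_shift hC1 hC2, hf.twoAlphabets_eq hp1 hC1, hg.twoAlphabets_eq hp2 hC2]

end SuperSeries

/-! ### The coproduct of quasisymmetric functions as a superalgebra morphism -/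

namespace SQSym

open SuperSeries DottedComp

/-- The product of `SQSym ⊗ SQSym` as a tensor product of superalgebras. -/
noncomputable def superMul :
    SQSym ⊗[ℚ] SQSym →ₗ[ℚ] SQSym ⊗[ℚ] SQSym →ₗ[ℚ] SQSym ⊗[ℚ] SQSym :=
  TensorProduct.map₂ mulL mulL +
    (-2 : ℚ) • TensorProduct.map₂ (mulL.compl₂ oddPart) (mulL ∘ₗ oddPart)

theorem superMul_tmul (a b c d : SQSym) :
    superMul (a ⊗ₜ b) (c ⊗ₜ d) = mulL a c ⊗ₜ mulL b d +
      (-2 : ℚ) • (mulL a (oddPart c) ⊗ₜ mulL (oddPart b) d) := rfl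

/-- The correction term survives only when `b` and `c` both have odd degree, and then the
coefficient is `1 - 2 = -1`. -/
theorem superMul_homogeneous {i j : ℕ} (a : SQSym) {b c : SQSym} (d : SQSym)
    (hb : IsFermionic i b) (hc : IsFermionic j c) :
    superMul (a ⊗ₜ b) (c ⊗ₜ d) = (-1 : ℚ) ^ (i * j) • (mulL a c ⊗ₜ[ℚ] mulL b d) := by
  rw [superMul_tmul, oddPart_of_isFermionic hb, oddPart_of_isFermionic hc]
  by_cases h : Odd (i * j)
  · rw [h.neg_one_pow, if_pos (Nat.odd_mul.1 h).1, if_pos (Nat.odd_mul.1 h).2]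
    module
  · rw [(Nat.not_odd_iff_even.1 h).neg_one_pow]
    rw [Nat.odd_mul, not_and_or] at h
    rcases h with h | h <;> simp [h]

/-- The right-hand side has the shape found in `twoAlphabets_mul`, so comparing the two yields
`comul_mulL`. By bilinearity only pure tensors matter. -/
theorem tensorToTwo_superMul (s t : SQSym ⊗[ℚ] SQSym) (n : ℕ →₀ ℕ) (A : Finset ℕ)
    (m : ℕ →₀ ℕ) (B : Finset ℕ) :
    tensorToTwo (superMul s t) n A m B =
      ∑ p ∈ Finset.HasAntidiagonal.antidiagonal n, ∑ q ∈ Finset.HasAntidiagonal.antidiagonal m,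
        ∑ C ∈ A.powerset, ∑ D ∈ B.powerset,
          (-1) ^ (D.card * (A \ C).card) * (sign C (A \ C) * sign D (B \ D)) *
            (tensorToTwo s p.1 C q.1 D * tensorToTwo t p.2 (A \ C) q.2 (B \ D)) := by
  induction s using TensorProduct.induction_on with
  | zero => simp
  | add s s' hs hs' =>
    simp only [map_add, LinearMap.add_apply, Pi.add_apply, hs, hs', add_mul, mul_add,
      Finset.sum_add_distrib]
  | tmul a b =>
    induction t using TensorProduct.induction_on with
    | zero => simp
    | add t t' ht ht' =>
      simp only [map_add, Pi.add_apply, ht, ht', mul_add, Finset.sum_add_distrib]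
    | tmul c d =>
      -- Stated for arbitrary series, because it is applied both to the main term and to the
      -- correction with odd parts.
      have hsplit : ∀ f g h k : SuperSeries, SuperSeries.mul f g n A * SuperSeries.mul h k m B =
          ∑ p ∈ Finset.HasAntidiagonal.antidiagonal n,
            ∑ q ∈ Finset.HasAntidiagonal.antidiagonal m,
            ∑ C ∈ A.powerset, ∑ D ∈ B.powerset, (sign C (A \ C) * sign D (B \ D)) *
              ((f p.1 C * h q.1 D) * (g p.2 (A \ C) * k q.2 (B \ D))) := by
        intro f g h k
        simp only [SuperSeries.mul, Finset.sum_mul_sum]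
        refine Finset.sum_congr rfl fun _ _ => Finset.sum_congr rfl fun _ _ =>
          Finset.sum_congr rfl fun _ _ => Finset.sum_congr rfl fun _ _ => ?_
        ring
      rw [superMul_tmul, map_add, map_smul]
      change SuperSeries.mul a.1 c.1 n A * SuperSeries.mul b.1 d.1 m B +
        -2 * (SuperSeries.mul a.1 (oddPart c).1 n A * SuperSeries.mul (oddPart b).1 d.1 m B) = _
      rw [hsplit, hsplit]
      simp only [Finset.mul_sum, ← Finset.sum_add_distrib, tensorToTwo_tmul]
      refine Finset.sum_congr rfl fun p _ => Finset.sum_congr rfl fun q _ =>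
        Finset.sum_congr rfl fun C _ => Finset.sum_congr rfl fun D _ => ?_
      change _ + -2 * (_ * ((_ * if Odd D.card then b.1 q.1 D else 0) *
        ((if Odd (A \ C).card then c.1 p.2 (A \ C) else 0) * _))) = _
      -- `D` carries the `φ`'s taken from `b` and `A \ C` the `θ`'s taken from `c`. The odd parts
      -- keep the term exactly when both cardinalities are odd, that is, when the super sign is
      -- `-1`.
      by_cases h : Odd (D.card * (A \ C).card)
      · rw [h.neg_one_pow, if_pos (Nat.odd_mul.1 h).1, if_pos (Nat.odd_mul.1 h).2]
        ring
      · rw [(Nat.not_odd_iff_even.1 h).neg_one_pow]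
        rw [Nat.odd_mul, not_and_or] at h
        rcases h with h | h <;> rw [if_neg h] <;> ring

/-- The coproduct of `SQSym` is a morphism of superalgebras. -/
theorem comul_mulL (a b : SQSym) : comul (mulL a b) = superMul (comul a) (comul b) := by
  apply tensorToTwo_injective
  rw [tensorToTwo_comul]
  funext n A m B
  rw [tensorToTwo_superMul, tensorToTwo_comul, tensorToTwo_comul]
  exact twoAlphabets_mul a.2.2 b.2.2 n A m B

theorem IsFermionic.mulL {i j : ℕ} {a b : SQSym} (ha : IsFermionic i a) (hb : IsFermionic j b) :
    IsFermionic (i + j) (mulL a b) := by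
  intro n S h
  refine Finset.sum_eq_zero fun p _ => Finset.sum_eq_zero fun A hA => ?_
  have h1 := card_add_card_sdiff hA
  by_cases h2 : A.card = i
  · rw [hb _ _ (by omega)]
    ring
  · rw [ha _ _ h2]
    ring

end SQSym

namespace SNSym

open SQSym SuperSeries DottedComp

variable {ε : ℤˣ}

/-! ### The coproduct is a morphism of superalgebras -/

theorem pairing_mul_M (F G : SNSym ε) (α : DottedComp) :
    pairing (F * G) (M α) = ∑ k ∈ Finset.range (α.length + 1),
      koszul ε (fermionicDegree (α.take k)) (fermionicDegree (α.drop k)) *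
        (pairing F (M (α.take k)) * pairing G (M (α.drop k))) :=
  pairTensor_comul_M ε _ _ α

theorem pairing_oddPart_M (F : SNSym ε) (α : DottedComp) :
    pairing (oddPart ε F) (M α) = if Odd (fermionicDegree α) then pairing F (M α) else 0 := by
  change pairing F (SQSym.oddPart (M α)) = _
  rw [SQSym.oddPart_of_isFermionic (M_isFermionic α)]
  split_ifs <;> simp

theorem pairing₂_tmul_M (F G : SNSym ε) (α β : DottedComp) :
    pairing₂ ε (F ⊗ₜ G) (M α ⊗ₜ M β) =
      koszul ε (fermionicDegree α) (fermionicDegree β) * (pairing F (M α) * pairing G (M β)) :=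
  pairTensor_M ε _ _ α β

theorem ext_M₂ {s t : SNSym ε ⊗[ℚ] SNSym ε}
    (h : ∀ α β, pairing₂ ε s (M α ⊗ₜ M β) = pairing₂ ε t (M α ⊗ₜ M β)) : s = t := by
  apply pairing₂_injective
  apply (basisM.tensorProduct basisM).ext
  rintro ⟨α, β⟩
  rw [Module.Basis.tensorProduct_apply, basisM_apply, basisM_apply]
  exact h α β

/-- Homogeneity of `a` and `b` alone determines the sign, so `F` and `G` are arbitrary. This form is
needed for products of monomial functions, to which `pairTensor_M` does not apply. -/
theorem pairTensor_isFermionic (F G : Module.Dual ℚ SQSym) {i j : ℕ} {a b : SQSym}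
    (ha : SQSym.IsFermionic i a) (hb : SQSym.IsFermionic j b) :
    pairTensor ε (F ⊗ₜ G) (a ⊗ₜ b) = koszul ε i j * (F a * G b) := by
  rw [pairTensor_apply, SQSym.oddPart_of_isFermionic ha, SQSym.oddPart_of_isFermionic hb,
    koszul_eq]
  by_cases h1 : Odd i <;> by_cases h2 : Odd j <;> simp [h1, h2]
  ring

theorem fermionicDegree_take_add_drop (α : DottedComp) (k : ℕ) :
    fermionicDegree (α.take k) + fermionicDegree (α.drop k) = fermionicDegree α := by
  rw [← fermionicDegree_append, List.take_append_drop]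

/-- The sign in the pairing of a product of `SNSym ⊗ SNSym` with `M_α ⊗ M_β`. -/
noncomputable def shuffleSign (ε : ℤˣ) (a₁ a₂ b₁ b₂ : ℕ) : ℚ :=
  (-1) ^ (a₂ * b₁) * koszul ε (a₁ + b₁) (a₂ + b₂)

/-- On either side the exponent of `ε` is the sum of all six pairwise products of `a₁, a₂, b₁, b₂`.
This coincidence is what makes the super sign on `SNSym ⊗ SNSym` the same for both pairings. -/
theorem shuffleSign_mul (ε : ℤˣ) (a₁ a₂ b₁ b₂ : ℕ) :
    shuffleSign ε a₁ a₂ b₁ b₂ * (koszul ε a₁ b₁ * koszul ε a₂ b₂) =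
      (-1) ^ (a₂ * b₁) * (koszul ε (a₁ + a₂) (b₁ + b₂) * (koszul ε a₁ a₂ * koszul ε b₁ b₂)) := by
  unfold shuffleSign koszul
  rw [mul_assoc]
  congr 1
  norm_cast
  simp only [← pow_add]
  congr 1
  ring

/-- The product of tensors is dual to cutting `α` and `β` independently and regrouping the pieces.
On pure tensors the values on the four pieces are the same on both sides, and only the signs have to
be compared. -/
theorem pairing₂_superMul (s t : SNSym ε ⊗[ℚ] SNSym ε) (α β : DottedComp) :
    pairing₂ ε (superMul ε s t) (M α ⊗ₜ M β) =
      ∑ k ∈ Finset.range (α.length + 1), ∑ l ∈ Finset.range (β.length + 1),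
        shuffleSign ε (fermionicDegree (α.take k)) (fermionicDegree (α.drop k))
            (fermionicDegree (β.take l)) (fermionicDegree (β.drop l)) *
          (pairing₂ ε s (M (α.take k) ⊗ₜ M (β.take l)) *
            pairing₂ ε t (M (α.drop k) ⊗ₜ M (β.drop l))) := by
  induction s using TensorProduct.induction_on with
  | zero => simp
  | add s s' hs hs' =>
    simp only [map_add, LinearMap.add_apply, hs, hs', add_mul, mul_add, Finset.sum_add_distrib]
  | tmul F₁ G₁ =>
    induction t using TensorProduct.induction_on with
    | zero => simp
    | add t t' ht ht' =>
      simp only [map_add, LinearMap.add_apply, ht, ht', mul_add, Finset.sum_add_distrib]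
    | tmul F₂ G₂ =>
      rw [superMul_tmul, map_sub, map_smul, LinearMap.sub_apply, LinearMap.smul_apply, smul_eq_mul,
        pairing₂_tmul_M, pairing₂_tmul_M]
      simp only [pairing_mul_M, Finset.sum_mul_sum]
      simp only [Finset.mul_sum, ← Finset.sum_sub_distrib,
        pairing₂_tmul_M, pairing_oddPart_M]
      refine Finset.sum_congr rfl fun k _ => Finset.sum_congr rfl fun l _ => ?_
      have h1 := shuffleSign_mul ε (fermionicDegree (α.take k)) (fermionicDegree (α.drop k))
        (fermionicDegree (β.take l)) (fermionicDegree (β.drop l))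
      rw [fermionicDegree_take_add_drop, fermionicDegree_take_add_drop] at h1
      set Q := pairing F₁ (M (α.take k)) * pairing F₂ (M (α.drop k)) *
        (pairing G₁ (M (β.take l)) * pairing G₂ (M (β.drop l)))
      -- The correction term sees `F₂` on `α.drop k` and `G₁` on `β.take l`. It survives only if
      -- both pieces are odd and then flips the sign; what remains is `Q` times the sign identity
      -- `h1`.
      by_cases h : Odd (fermionicDegree (α.drop k) * fermionicDegree (β.take l))
      · rw [h.neg_one_pow] at h1
        rw [if_pos (Nat.odd_mul.1 h).1, if_pos (Nat.odd_mul.1 h).2]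
        linear_combination -Q * h1
      · rw [(Nat.not_odd_iff_even.1 h).neg_one_pow] at h1
        rw [Nat.odd_mul, not_and_or] at h
        rcases h with h | h <;> rw [if_neg h] <;> linear_combination -Q * h1

/-- Pairing `Δ(FG)` with `M_α ⊗ M_β` gives `⟨F ⊗ G, Δ(M_α M_β)⟩`. Since `Δ` is multiplicative on
`SQSym`, this is a double sum over cuts of `α` and `β`, which matches `pairing₂_superMul` term by
term. -/
theorem comul_mul (F G : SNSym ε) :
    comul ε (F * G) = superMul ε (comul ε F) (comul ε G) := by
  apply ext_M₂
  intro α β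
  rw [pairing₂_superMul, pairing₂_comul, pairing_mul, comul_mulL, comul_M, comul_M]
  simp only [map_sum, LinearMap.sum_apply]
  rw [Finset.sum_comm]
  refine Finset.sum_congr rfl fun k _ => Finset.sum_congr rfl fun l _ => ?_
  -- Exchanging the middle factors `M (α.drop k)` and `M (β.take l)` gives the power of `-1`;
  -- pairing with the two products, whose degrees are sums, gives the power of `ε`. Together they
  -- are `shuffleSign`.
  rw [SQSym.superMul_homogeneous _ _ (M_isFermionic _) (M_isFermionic _), map_smul, smul_eq_mul,
    pairTensor_isFermionic _ _ ((M_isFermionic _).mulL (M_isFermionic _))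
      ((M_isFermionic _).mulL (M_isFermionic _)), pairing₂_comul, pairing₂_comul, shuffleSign,
    mul_assoc]

/-! ### The coproduct on the generators -/

/-- For `n = 0` the monomial is `1` and carries the empty composition, in accordance with `H_0 = 1`.
Hence `Heven_eq` needs no case distinction afterwards. -/
theorem comp_single_empty (n : ℕ) :
    comp (Finsupp.single 0 n) ∅ = if h : 0 < n then [.plain ⟨n, h⟩] else [] := by
  split_ifs with h
  · simp [comp, Finsupp.support_single _ h.ne', partAt, h]
  · obtain rfl : n = 0 := by omega
    simp [comp]

theorem comp_single_singleton (n : ℕ) : comp (Finsupp.single 0 n) {0} = [.dotted n] := by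
  have : (Finsupp.single 0 n).support ∪ {0} = {0} :=
    Finset.union_eq_right.2 Finsupp.support_single_subset
  simp [comp, this, partAt]

theorem Heven_eq (n : ℕ) : Heven ε n = H ε (comp (Finsupp.single 0 n) ∅) := by
  rw [comp_single_empty, Heven]
  split_ifs
  · rfl
  · exact unit_eq ε

theorem Hodd_eq (n : ℕ) : Hodd ε n = H ε (comp (Finsupp.single 0 n) {0}) := by
  rw [comp_single_singleton, Hodd]

/-- By quasisymmetry the coefficient of a monomial function can be read at any monomial carrying its
composition. Applied to a product `f`, this turns the coproduct of a generator into a coefficient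
computation. -/
theorem pairing_H_comp (n : ℕ →₀ ℕ) (S : Finset ℕ) (f : SQSym) :
    pairing (H ε (comp n S)) f = f.1 n S := by
  change basisM.coord (comp n S) f = _
  rw [Module.Basis.coord_apply, basisM_repr, f.2.2.coeff_eq]

/-- Unless the degrees of `α` and `β` are the sizes of `S` and `T`, both sides vanish. If they are,
one of them is `0` and the sign is trivial, so `ε` plays no role for the generators. -/
theorem pairing₂_H_comp (n m : ℕ →₀ ℕ) (S T : Finset ℕ) (hST : S = ∅ ∨ T = ∅)
    (α β : DottedComp) :
    pairing₂ ε (H ε (comp n S) ⊗ₜ H ε (comp m T)) (M α ⊗ₜ M β) = (M α).1 n S * (M β).1 m T := by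
  rw [pairing₂_tmul_M, pairing_H_comp, pairing_H_comp]
  by_cases h1 : fermionicDegree α = S.card
  · by_cases h2 : fermionicDegree β = T.card
    · rw [h1, h2, koszul_eq, if_neg, one_mul]
      rcases hST with rfl | rfl <;> simp
    · rw [M_isFermionic β m T (Ne.symm h2)]
      ring
  · rw [M_isFermionic α n S (Ne.symm h1)]
    ring

theorem sum_antidiagonal_single (n : ℕ) (c : (ℕ →₀ ℕ) → (ℕ →₀ ℕ) → ℚ) :
    ∑ p ∈ Finset.HasAntidiagonal.antidiagonal (Finsupp.single 0 n), c p.1 p.2 =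
      ∑ p ∈ Finset.HasAntidiagonal.antidiagonal n,
        c (Finsupp.single 0 p.1) (Finsupp.single 0 p.2) := by
  rw [Finsupp.antidiagonal_single, Finset.sum_map]
  rfl

theorem comul_Heven (n : ℕ) : comul ε (Heven ε n) =
    ∑ p ∈ Finset.HasAntidiagonal.antidiagonal n, Heven ε p.1 ⊗ₜ[ℚ] Heven ε p.2 := by
  apply ext_M₂
  intro α β
  simp only [Heven_eq, map_sum, LinearMap.sum_apply, pairing₂_H_comp _ _ ∅ ∅ (Or.inl rfl)]
  rw [pairing₂_comul, pairing_H_comp]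
  change SuperSeries.mul (M α).1 (M β).1 _ _ = _
  rw [SuperSeries.mul, sum_antidiagonal_single n fun p q => ∑ A ∈ (∅ : Finset ℕ).powerset,
    sign A (∅ \ A) * ((M α).1 p A * (M β).1 q (∅ \ A))]
  simp [sign]

theorem comul_Hodd (n : ℕ) : comul ε (Hodd ε n) =
    ∑ p ∈ Finset.HasAntidiagonal.antidiagonal n,
      (Hodd ε p.1 ⊗ₜ[ℚ] Heven ε p.2 + Heven ε p.2 ⊗ₜ[ℚ] Hodd ε p.1) := by
  -- In the second family the dotted index `p.1` sits in the right tensor factor. Swapping lets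
  -- `p.1` be the exponent of the left factor in both families, as in the product of series.
  rw [Finset.sum_add_distrib,
    ← Finset.Nat.sum_antidiagonal_swap (f := fun p => Heven ε p.2 ⊗ₜ[ℚ] Hodd ε p.1)]
  apply ext_M₂
  intro α β
  simp only [Heven_eq, Hodd_eq, map_add, LinearMap.add_apply, map_sum, LinearMap.sum_apply,
    pairing₂_H_comp _ _ ∅ {0} (Or.inl rfl), pairing₂_H_comp _ _ {0} ∅ (Or.inr rfl),
    Prod.fst_swap, Prod.snd_swap]
  rw [pairing₂_comul, pairing_H_comp]
  change SuperSeries.mul (M α).1 (M β).1 _ _ = _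
  rw [SuperSeries.mul, sum_antidiagonal_single n fun p q => ∑ A ∈ ({0} : Finset ℕ).powerset,
    sign A ({0} \ A) * ((M α).1 p A * (M β).1 q ({0} \ A)), ← Finset.sum_add_distrib]
  refine Finset.sum_congr rfl fun p _ => ?_
  -- The single `θ_0` is contributed by the right factor for `A = ∅` and by the left factor for `A =
  -- {0}`; neither choice creates an inversion.
  have : ({0} : Finset ℕ).powerset = {∅, {0}} := rfl
  rw [this, Finset.sum_pair (Finset.singleton_ne_empty 0).symm]
  simp [sign, add_comm]

theorem comul_one : comul ε 1 = 1 ⊗ₜ[ℚ] 1 := by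
  have h : Heven ε 0 = 1 := rfl
  rw [← h, comul_Heven]
  simp

/-! ### The free algebra -/

/-- The sign in `mulL_H` is its own inverse, so it can be moved to the other side. -/
theorem H_cons (p : DottedPart) (α : DottedComp) :
    H ε (p :: α) = koszul ε p.eta (fermionicDegree α) • (H ε [p] * H ε α) := by
  have h : H ε [p] * H ε α = koszul ε (fermionicDegree [p]) (fermionicDegree α) • H ε ([p] ++ α) :=
    mulL_H ε [p] α
  have hp : fermionicDegree [p] = p.eta := by simp [fermionicDegree]
  rw [h, hp, smul_smul, koszul_mul_self, one_smul, List.singleton_append]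

theorem koszul_smul (ε : ℤˣ) (a b : ℕ) (F : SNSym ε) :
    koszul ε a b • F = ε ^ (a * b) • F := by
  rw [koszul, Int.cast_smul_eq_zsmul, ← Units.smul_def]

theorem H_eq_prod (α : DottedComp) : H ε α =
    ε ^ (fermionicDegree α).choose 2 • (α.map fun p => H ε [p]).prod := by
  induction α with
  | nil =>
    rw [← unit_eq]
    simp only [fermionicDegree, List.map_nil, List.sum_nil, List.prod_nil, Nat.choose_zero_succ,
      pow_zero, one_smul]
    rfl
  | cons p α ih =>
    -- The pairs of dotted parts in `p :: α` are those inside `α` and, if `p` is dotted, those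
    -- formed by `p` with a dotted part of `α`.
    have hchoose : (fermionicDegree (p :: α)).choose 2 =
        p.eta * fermionicDegree α + (fermionicDegree α).choose 2 := by
      have : fermionicDegree (p :: α) = p.eta + fermionicDegree α := by simp [fermionicDegree]
      rw [this]
      rcases p with m | m
      · simp [DottedPart.eta]
      · simp [DottedPart.eta, Nat.add_comm 1, Nat.choose_succ_succ']
    rw [H_cons, koszul_smul, ih, List.map_cons, List.prod_cons, mul_smul_comm, smul_smul, hchoose,
      pow_add]

/-- The algebra morphism from the free algebra that sends the generators to the `H_p`. -/
noncomputable def ofFree (ε : ℤˣ) : FreeAlgebra ℚ DottedPart →ₐ[ℚ] SNSym ε :=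
  FreeAlgebra.lift ℚ fun p => H ε [p]

theorem basisFreeMonoid_apply (w : FreeMonoid DottedPart) :
    FreeAlgebra.basisFreeMonoid ℚ DottedPart w = FreeMonoid.lift (FreeAlgebra.ι ℚ) w := by
  simp [FreeAlgebra.basisFreeMonoid, FreeAlgebra.equivMonoidAlgebraFreeMonoid]

/-- A word in the parts is a dotted composition, and `H_eq_prod` can be solved for the product
because its sign squares to `1`. The sign is written as a unit of `ℚ`, the form in which it rescales
a basis. -/
theorem ofFree_basisFreeMonoid (w : FreeMonoid DottedPart) :
    ofFree ε (FreeAlgebra.basisFreeMonoid ℚ DottedPart w) =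
      Units.map (Int.castRingHom ℚ).toMonoidHom (ε ^ (fermionicDegree w.toList).choose 2) •
        basisH ε w.toList := by
  rw [basisFreeMonoid_apply, basisH_apply, FreeMonoid.lift_apply, map_list_prod, List.map_map]
  have h : ⇑(ofFree ε) ∘ FreeAlgebra.ι ℚ = fun p => H ε [p] := by
    funext p
    simp [ofFree]
  have hu : ∀ (u : ℤˣ) (F : SNSym ε), Units.map (Int.castRingHom ℚ).toMonoidHom u • F = u • F := by
    intro u F
    rw [Units.smul_def, Units.smul_def]
    exact Int.cast_smul_eq_zsmul ℚ (u : ℤ) F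
  rw [h, hu, H_eq_prod, smul_smul, Int.units_mul_self, one_smul]

/-- The map sends the basis of words to the basis `basisH` rescaled by signs, indexed through the
identification of words with lists. A linear map carrying one basis onto another in this way is an
isomorphism. -/
theorem ofFree_bijective (ε : ℤˣ) : Function.Bijective (ofFree ε) := by
  let b := (basisH ε).unitsSMul fun α =>
    Units.map (Int.castRingHom ℚ).toMonoidHom (ε ^ (fermionicDegree α).choose 2)
  let e := (FreeAlgebra.basisFreeMonoid ℚ DottedPart).equiv b FreeMonoid.toList
  have h : (ofFree ε).toLinearMap = e.toLinearMap := by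
    apply (FreeAlgebra.basisFreeMonoid ℚ DottedPart).ext
    intro w
    rw [AlgHom.toLinearMap_apply, ofFree_basisFreeMonoid, LinearEquiv.coe_coe,
      Module.Basis.equiv_apply, Module.Basis.unitsSMul_apply]
  have h' : ⇑(ofFree ε) = e := congrArg DFunLike.coe h
  rw [h']
  exact e.bijective

end SNSym

theorem mainTheorem8 (ε : ℤˣ) :
    -- the `H_α` form the basis dual to the `M_α`, which form a basis of `SQSym`
    (LinearIndependent ℚ SQSym.M ∧ Submodule.span ℚ (Set.range SQSym.M) = ⊤) ∧
    (LinearIndependent ℚ (SNSym.H ε) ∧ Submodule.span ℚ (Set.range (SNSym.H ε)) = ⊤) ∧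
    (∀ α β : DottedComp, SNSym.pairing (SNSym.H ε α) (SQSym.M β) = if α = β then 1 else 0) ∧
    -- each `H_α` is, up to a sign that is `1` for `ε = 1`, the product of the generators
    (∀ α : DottedComp, SNSym.H ε α =
      ε ^ (DottedComp.fermionicDegree α).choose 2 • (α.map fun p => SNSym.H ε [p]).prod) ∧
    -- `SNSym` is the free associative algebra on `H_m` (`m ≥ 1`) and `H̃_n` (`n ≥ 0`)
    (∃ Φ : FreeAlgebra ℚ DottedPart ≃ₐ[ℚ] SNSym ε,
      (∀ m : ℕ+, Φ (FreeAlgebra.ι ℚ (.plain m)) = SNSym.Heven ε m) ∧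
      (∀ n : ℕ, Φ (FreeAlgebra.ι ℚ (.dotted n)) = SNSym.Hodd ε n)) ∧
    -- the coproduct on the generators
    (∀ n : ℕ, 1 ≤ n → SNSym.comul ε (SNSym.Heven ε n) =
      ∑ p ∈ Finset.HasAntidiagonal.antidiagonal n, SNSym.Heven ε p.1 ⊗ₜ[ℚ] SNSym.Heven ε p.2) ∧
    (∀ i : ℕ, SNSym.comul ε (SNSym.Hodd ε i) =
      ∑ p ∈ Finset.HasAntidiagonal.antidiagonal i,
        (SNSym.Hodd ε p.1 ⊗ₜ[ℚ] SNSym.Heven ε p.2 + SNSym.Heven ε p.2 ⊗ₜ[ℚ] SNSym.Hodd ε p.1)) ∧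
    -- the coproduct is a morphism of superalgebras, hence determined by its values on generators
    SNSym.comul ε 1 = 1 ⊗ₜ[ℚ] 1 ∧
    (∀ F G : SNSym ε,
      SNSym.comul ε (F * G) = SNSym.superMul ε (SNSym.comul ε F) (SNSym.comul ε G)) := by
  refine ⟨⟨?_, ?_⟩, ⟨SNSym.linearIndependent_H ε, top_unique (SNSym.span_H ε)⟩, SNSym.pairing_H,
    SNSym.H_eq_prod, ⟨AlgEquiv.ofBijective (SNSym.ofFree ε) (SNSym.ofFree_bijective ε), ?_, ?_⟩,
    fun n _ => SNSym.comul_Heven n, SNSym.comul_Hodd, SNSym.comul_one, SNSym.comul_mul⟩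
  · rw [← funext SQSym.basisM_apply]
    exact SQSym.basisM.linearIndependent
  · rw [← funext SQSym.basisM_apply]
    exact SQSym.basisM.span_eq
  · intro m
    rw [AlgEquiv.ofBijective_apply, SNSym.ofFree, FreeAlgebra.lift_ι_apply, SNSym.Heven,
      dif_pos m.pos]
    rfl
  · intro n
    rw [AlgEquiv.ofBijective_apply, SNSym.ofFree, FreeAlgebra.lift_ι_apply, SNSym.Hodd]
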